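/- Let $\mathbb K\in\{\mathbb R,\mathbb C\}$, let $V,H$ be separable Hilbert spaces over $\mathbb K$ with $V$ continuously and densely embedded in $H$, and let $V'$ be the antidual of $V$ (the dual if $\mathbb K=\mathbb R$). Identify $h\in H$ with the functional $v\mapsto (h\mid v)_H$ on $V$, so that $V\hookrightarrow H\hookrightarrow V'$. Let $T>0$ and let $\mathfrak a\colon[0,T]\times V\times V\to\mathbb K$ be sesquilinear in the last two variables, with $t\mapsto\mathfrak a(t,u,v)$ measurable for all $u,v\in V$. Suppose that there are constants $M,\dot M\ge 0$, $\alpha>0$ and $\omega\in\mathbb R$ such that for all $t,s\in[0,T]$ and $u,v\in V$: - ($V$-bounded) $|\mathfrak a(t,u,v)|\le M\|u\|_V\|v\|_V$; - (quasi-coercive) $\operatorname{Re}\mathfrak a(t,u,u)+\omega\|u\|_H^2\ge\alpha\|u\|_V^2$; - (symmetric) $\mathfrak a(t,u,v)=\overline{\mathfrak a(t,v,u)}$; - (Lipschitz) $|\mathfrak a(t,u,v)-\mathfrak a(s,u,v)|\le\dot M|t-s|\,\|u\|_V\|v\|_V$. Let $\mathcal A(t)\in\mathcal L(V,V')$ be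 given by $\langle\mathcal A(t)u,v\rangle=\mathfrak a(t,u,v)$. Then for every $u_0\in V$, $u_1\in H$ and $f\in L^2(0,T;H)$ there exists a unique $$u\in L^2(0,T;V)\cap H^1(0,T;H)\cap H^2(0,T;V')$$ such that $$\ddot u(t)+\mathcal A(t)u(t)=f(t)\ \text{ in } V' \text{ for a.e. } t\in(0,T),\qquad u(0)=u_0,\quad \dot u(0)=u_1,$$ where the initial values are taken for the continuous representatives $u\in C([0,T];H)$ and $\dot u\in C([0,T];V')$. Moreover, for this $u$, the continuous representative satisfies $u(t)\in V$ for all $t\in[0,T]$. -/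

import Mathlib

open MeasureTheory Set
open scoped ENNReal ContDiff ComplexConjugate

noncomputable section

namespace WaveMR

/-- The antidual `V'` of `V`: bounded antilinear functionals on `V` (the dual when `𝕜 = ℝ`),
with the operator norm. -/
abbrev AntiDual (𝕜 V : Type*) [RCLike 𝕜] [NormedAddCommGroup V] [InnerProductSpace 𝕜 V] :=
  V →L⋆[𝕜] 𝕜

/-- `L²(0,T;E)`. -/
abbrev L2 (T : ℝ) (E : Type*) [NormedAddCommGroup E] :=
  Lp E 2 (volume.restrict (Ioo (0 : ℝ) T))

section WeakDerivative

/-- `g'` is the weak derivative of `g` on `(0,T)`: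
`∫ φ' g = - ∫ φ g'` for all `φ ∈ C_c^∞(0,T)`. -/
def IsWeakDeriv {E : Type*} [NormedAddCommGroup E] [NormedSpace ℝ E] (T : ℝ) (g g' : ℝ → E) :
    Prop :=
  ∀ φ : ℝ → ℝ, ContDiff ℝ ∞ φ → HasCompactSupport φ → tsupport φ ⊆ Ioo 0 T →
    ∫ t in Ioo 0 T, deriv φ t • g t = - ∫ t in Ioo 0 T, φ t • g' t

/-- `U` is a representative of `g` (a function on `(0,T)` up to null sets) which is continuous
on `[0,T]`. -/
def IsContRep {E : Type*} [NormedAddCommGroup E] (T : ℝ) (g U : ℝ → E) : Prop :=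
  ContinuousOn U (Icc 0 T) ∧ U =ᵐ[volume.restrict (Ioo 0 T)] g

/-- `g(0) = x`, the value at `0` being that of the continuous representative of `g`. -/
def HasInitialValue {E : Type*} [NormedAddCommGroup E] (T : ℝ) (g : ℝ → E) (x : E) : Prop :=
  ∃ U : ℝ → E, IsContRep T g U ∧ U 0 = x

end WeakDerivative

section Forms

variable {𝕜 V H : Type*} [RCLike 𝕜] [NormedAddCommGroup V] [InnerProductSpace 𝕜 V]
  [NormedAddCommGroup H] [InnerProductSpace 𝕜 H]

/-- The embedding `H → V'` induced by `j : V → H`: `h ↦ (v ↦ (h | v)_H)`. (The scalar product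
`(h | v)_H`, linear in `h`, is `inner 𝕜 v h` in Mathlib.) -/
def toAntiDual (j : V →L[𝕜] H) (h : H) : AntiDual 𝕜 V :=
  (innerSLFlip 𝕜 h).comp j

theorem toAntiDual_apply (j : V →L[𝕜] H) (h : H) (v : V) :
    toAntiDual j h v = inner 𝕜 (j v) h := rfl

variable {T : ℝ}

/-- `V`-bounded non-autonomous sesquilinear form: uniformly bounded in `t ∈ [0,T]`, and
measurable in `t`. (Sesquilinearity is part of the type of `a`.) -/
structure IsVBounded (a : Icc (0 : ℝ) T → V →ₗ[𝕜] V →ₗ⋆[𝕜] 𝕜) : Prop where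
  bound : ∃ M : ℝ, ∀ (t : Icc (0 : ℝ) T) (u v : V), ‖a t u v‖ ≤ M * ‖u‖ * ‖v‖
  meas : ∀ u v : V, Measurable fun t : Icc (0 : ℝ) T => a t u v

/-- Quasi-coercivity with respect to `j : V → H`. -/
def IsQuasiCoercive (j : V →L[𝕜] H) (a : Icc (0 : ℝ) T → V →ₗ[𝕜] V →ₗ⋆[𝕜] 𝕜) : Prop :=
  ∃ α : ℝ, 0 < α ∧ ∃ w : ℝ, ∀ (t : Icc (0 : ℝ) T) (u : V),
    α * ‖u‖ ^ 2 ≤ RCLike.re (a t u u) + w * ‖j u‖ ^ 2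

def IsSymmetricForm (a : Icc (0 : ℝ) T → V →ₗ[𝕜] V →ₗ⋆[𝕜] 𝕜) : Prop :=
  ∀ (t : Icc (0 : ℝ) T) (u v : V), a t u v = conj (a t v u)

def IsLipschitzForm (a : Icc (0 : ℝ) T → V →ₗ[𝕜] V →ₗ⋆[𝕜] 𝕜) : Prop :=
  ∃ L : ℝ, ∀ (t s : Icc (0 : ℝ) T) (u v : V),
    ‖a t u v - a s u v‖ ≤ L * |(t : ℝ) - s| * ‖u‖ * ‖v‖

/-- The operator `𝒜(t) ∈ ℒ(V,V')` associated with the form: `⟨𝒜(t)u, v⟩ = a(t,u,v)`. -/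
def formOp {a : Icc (0 : ℝ) T → V →ₗ[𝕜] V →ₗ⋆[𝕜] 𝕜} (ha : IsVBounded a)
    (t : Icc (0 : ℝ) T) : V →L[𝕜] AntiDual 𝕜 V :=
  (a t).mkContinuous₂ ha.bound.choose (ha.bound.choose_spec t)

theorem formOp_apply {a : Icc (0 : ℝ) T → V →ₗ[𝕜] V →ₗ⋆[𝕜] 𝕜} (ha : IsVBounded a)
    (t : Icc (0 : ℝ) T) (u v : V) : formOp ha t u v = a t u v := rfl

/-- `u` belongs to `MR(V,H,V') = L²(0,T;V) ∩ H¹(0,T;H) ∩ H²(0,T;V')`, with first and second weak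
derivatives `u'` and `u''`; `V ⊆ H ⊆ V'` via `j` and `toAntiDual j`. -/
structure HasMRDerivs (j : V →L[𝕜] H) (u : L2 T V) (u' : L2 T H) (u'' : L2 T (AntiDual 𝕜 V)) :
    Prop where
  first : letI : NormedSpace ℝ H := NormedSpace.restrictScalars ℝ 𝕜 H
    IsWeakDeriv T (fun t => j (u t)) u'
  second : IsWeakDeriv T (fun t => toAntiDual j (u' t)) u''

/-- `u ∈ MR(V,H,V')` solves `ü + 𝒜(t)u = f` in `V'` for a.e. `t ∈ (0,T)`, and `u(0) = u₀`,
`u̇(0) = u₁`. The initial values are those of the continuous representatives of `u` in `H` and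
of `u̇` in `V'`. -/
def IsWaveSolution (j : V →L[𝕜] H) {a : Icc (0 : ℝ) T → V →ₗ[𝕜] V →ₗ⋆[𝕜] 𝕜}
    (ha : IsVBounded a) (f : L2 T H) (u₀ : V) (u₁ : H) (u : L2 T V) : Prop :=
  ∃ (u' : L2 T H) (u'' : L2 T (AntiDual 𝕜 V)), HasMRDerivs j u u' u'' ∧
    (∀ᵐ t : ℝ, ∀ ht : t ∈ Ioo 0 T,
      u'' t + formOp ha ⟨t, Ioo_subset_Icc_self ht⟩ (u t) = toAntiDual j (f t)) ∧
    HasInitialValue T (fun t => j (u t)) (j u₀) ∧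
    HasInitialValue T (fun t => toAntiDual j (u' t)) (toAntiDual j u₁)

end Forms

end WaveMR

end

/-
Identify `V'` with `V` by the Riesz isomorphism, so that `H → V'` becomes the adjoint of `j`, and
integrate the wave equation once in time.

Existence is Lions' representation theorem. Weighting the test function `ẇ` by `exp (-λ t)` with
`λ` large makes the problem coercive on the space of trajectories
`(w, j ẇ, w 0, w T, j (ẇ 0))`; the Lipschitz bound on the form controls the derivative of the
energy. The values at `0` and at `T` are components of their own in this space, so that the solution
obtained in its closure has boundary values in `V`.

Uniqueness is Ladyzhenskaya's argument: the difference of two solutions is not regular enough to be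
tested with its own derivative, so test with `-∫ s in t..T, exp (-λ s) • u s`.

Restricted to `[0, s]`, the solution coincides with the one constructed there, whose value at the
right end point `s` lies in `V`.
-/

namespace WaveMR

section IndefiniteIntegral

open Filter Topology AbsolutelyContinuousOnInterval

variable {E F G : Type*} [NormedAddCommGroup E] [NormedSpace ℝ E]
  [NormedAddCommGroup F] [NormedSpace ℝ F] [NormedAddCommGroup G] [NormedSpace ℝ G]
  {a b : ℝ}

/-- `f` is an indefinite integral of `f'` on the interval with endpoints `a` and `b`: the absolutely
continuous functions in which the energy estimates take place. -/
structure IsPrimitiveOn (f f' : ℝ → E) (a b : ℝ) : Prop where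
  intervalIntegrable : IntervalIntegrable f' volume a b
  eq_add_integral : ∀ t ∈ uIcc a b, f t = f a + ∫ s in a..t, f' s

theorem absolutelyContinuousOnInterval_of_dist_le {X Y : Type*} [PseudoMetricSpace X]
    [PseudoMetricSpace Y] {f : ℝ → X} {g : ℝ → Y} (hg : AbsolutelyContinuousOnInterval g a b)
    (h : ∀ x ∈ uIcc a b, ∀ y ∈ uIcc a b, dist (f x) (f y) ≤ dist (g x) (g y)) :
    AbsolutelyContinuousOnInterval f a b := by
  refine squeeze_zero' (Eventually.of_forall fun _ => Finset.sum_nonneg fun _ _ => dist_nonneg)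
    ?_ hg
  rw [eventually_inf_principal]
  exact Eventually.of_forall fun I hI =>
    Finset.sum_le_sum fun i hi => h _ (hI.1 i hi).1 _ (hI.1 i hi).2

theorem absolutelyContinuousOnInterval_bilin (L : E →L[ℝ] F →L[ℝ] G) {f : ℝ → E} {g : ℝ → F}
    (hf : AbsolutelyContinuousOnInterval f a b) (hg : AbsolutelyContinuousOnInterval g a b) :
    AbsolutelyContinuousOnInterval (fun t => L (f t) (g t)) a b := by
  obtain ⟨C, hC⟩ := hf.exists_bound
  obtain ⟨D, hD⟩ := hg.exists_bound
  have dist_le : ∀ x ∈ uIcc a b, ∀ y ∈ uIcc a b, dist (L (f x) (g x)) (L (f y) (g y)) ≤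
      ‖L‖ * D * dist (f x) (f y) + ‖L‖ * C * dist (g x) (g y) := by
    intro x hx y hy
    have split : L (f x) (g x) - L (f y) (g y) = L (f x - f y) (g x) + L (f y) (g x - g y) := by
      simp
    rw [dist_eq_norm, split, dist_eq_norm, dist_eq_norm, mul_right_comm]
    exact (norm_add_le _ _).trans (add_le_add (L.le_of_opNorm₂_le_of_le le_rfl le_rfl (hD x hx))
      (L.le_of_opNorm₂_le_of_le le_rfl (hC y hy) le_rfl))
  refine squeeze_zero' (Eventually.of_forall fun _ => Finset.sum_nonneg fun _ _ => dist_nonneg)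
    ?_ (by simpa using (Tendsto.const_mul (‖L‖ * D) hf).add (Tendsto.const_mul (‖L‖ * C) hg))
  rw [eventually_inf_principal]
  refine Eventually.of_forall fun I hI => ?_
  rw [Finset.mul_sum, Finset.mul_sum, ← Finset.sum_add_distrib]
  exact Finset.sum_le_sum fun i hi => dist_le _ (hI.1 i hi).1 _ (hI.1 i hi).2

theorem intervalIntegrable_bilin_continuousOn (L : E →L[ℝ] F →L[ℝ] G) {f : ℝ → E} {g : ℝ → F}
    (hf : IntervalIntegrable f volume a b) (hg : ContinuousOn g (uIcc a b)) :
    IntervalIntegrable (fun t => L (f t) (g t)) volume a b := by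
  obtain ⟨C, hC⟩ := isCompact_uIcc.exists_bound_of_continuousOn hg
  rw [intervalIntegrable_iff] at hf ⊢
  refine Integrable.mono' (hf.norm.const_mul (‖L‖ * C)) ?_ ?_
  · exact L.aestronglyMeasurable_comp₂ hf.aestronglyMeasurable
      ((hg.mono uIoc_subset_uIcc).aestronglyMeasurable measurableSet_uIoc)
  · filter_upwards [ae_restrict_mem measurableSet_uIoc] with t ht
    rw [mul_right_comm]
    exact L.le_of_opNorm₂_le_of_le le_rfl le_rfl (hC t (uIoc_subset_uIcc ht))

theorem isPrimitiveOn_integral {f' : ℝ → E} (hf' : IntervalIntegrable f' volume a b) (c : E) :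
    IsPrimitiveOn (fun t => c + ∫ s in a..t, f' s) f' a b :=
  ⟨hf', fun t _ => by simp⟩

theorem isPrimitiveOn_of_hasDerivAt [CompleteSpace E] {f f' : ℝ → E}
    (hf : ∀ t, HasDerivAt f (f' t) t) (hf' : Continuous f') (a b : ℝ) : IsPrimitiveOn f f' a b :=
  ⟨hf'.intervalIntegrable a b, fun t _ => by
    rw [intervalIntegral.integral_eq_sub_of_hasDerivAt (fun s _ => hf s)
      (hf'.intervalIntegrable a t), add_sub_cancel]⟩

namespace IsPrimitiveOn

variable {f f' : ℝ → E} {g g' : ℝ → F}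

theorem dist_eq_norm_integral (hf : IsPrimitiveOn f f' a b) {x y : ℝ} (hx : x ∈ uIcc a b)
    (hy : y ∈ uIcc a b) : dist (f y) (f x) = ‖∫ s in x..y, f' s‖ := by
  have integrable_to : ∀ z ∈ uIcc a b, IntervalIntegrable f' volume a z := fun z hz =>
    hf.intervalIntegrable.mono_set (uIcc_subset_uIcc left_mem_uIcc hz)
  rw [dist_eq_norm, hf.eq_add_integral x hx, hf.eq_add_integral y hy, add_sub_add_left_eq_sub,
    intervalIntegral.integral_interval_sub_left (integrable_to y hy) (integrable_to x hx)]

theorem absolutelyContinuousOnInterval (hf : IsPrimitiveOn f f' a b) :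
    AbsolutelyContinuousOnInterval f a b := by
  have hnorm := hf.intervalIntegrable.norm
  refine absolutelyContinuousOnInterval_of_dist_le
    (hnorm.absolutelyContinuousOnInterval_intervalIntegral left_mem_uIcc) fun x hx y hy => ?_
  have hprim := isPrimitiveOn_integral hnorm 0
  simp only [zero_add] at hprim
  rw [hf.dist_eq_norm_integral hy hx, hprim.dist_eq_norm_integral hy hx]
  exact intervalIntegral.norm_integral_le_abs_integral_norm

theorem continuousOn (hf : IsPrimitiveOn f f' a b) : ContinuousOn f (uIcc a b) :=
  hf.absolutelyContinuousOnInterval.continuousOn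

theorem ae_hasDerivAt [CompleteSpace E] (hf : IsPrimitiveOn f f' a b) :
    ∀ᵐ t, t ∈ uIcc a b → HasDerivAt f (f' t) t := by
  filter_upwards [hf.intervalIntegrable.ae_hasDerivAt_integral, Measure.ae_ne volume (min a b),
    Measure.ae_ne volume (max a b)] with t hderiv hmin hmax ht
  refine ((hderiv ht a left_mem_uIcc).const_add (f a)).congr_of_eventuallyEq ?_
  filter_upwards [Icc_mem_nhds (ht.1.lt_of_ne' hmin) (ht.2.lt_of_ne hmax)] with s hs
  exact hf.eq_add_integral s hs

theorem of_absolutelyContinuousOnInterval [CompleteSpace E]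
    (hf : AbsolutelyContinuousOnInterval f a b) (hf' : IntervalIntegrable f' volume a b)
    (hderiv : ∀ᵐ t, t ∈ uIcc a b → HasDerivAt f (f' t) t) : IsPrimitiveOn f f' a b := by
  have hprim := isPrimitiveOn_integral hf' 0
  obtain ⟨c, hc⟩ := (hf.fun_sub hprim.absolutelyContinuousOnInterval).const_of_ae_hasDerivAt_zero
    (by filter_upwards [hderiv, hprim.ae_hasDerivAt] with t h1 h2 ht
        simpa using (h1 ht).fun_sub (h2 ht))
  refine ⟨hf', fun t ht => ?_⟩
  have ha := hc a left_mem_uIcc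
  simp only [intervalIntegral.integral_same, add_zero, sub_zero, zero_add] at ha hc
  rw [ha, ← hc t ht, sub_add_cancel]

theorem bilin [CompleteSpace E] [CompleteSpace F] [CompleteSpace G] (L : E →L[ℝ] F →L[ℝ] G)
    (hf : IsPrimitiveOn f f' a b) (hg : IsPrimitiveOn g g' a b) :
    IsPrimitiveOn (fun t => L (f t) (g t)) (fun t => L (f' t) (g t) + L (f t) (g' t)) a b := by
  refine of_absolutelyContinuousOnInterval
    (absolutelyContinuousOnInterval_bilin L hf.absolutelyContinuousOnInterval
      hg.absolutelyContinuousOnInterval)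
    ((intervalIntegrable_bilin_continuousOn L hf.intervalIntegrable hg.continuousOn).add
      (intervalIntegrable_bilin_continuousOn L.flip hg.intervalIntegrable hf.continuousOn)) ?_
  filter_upwards [hf.ae_hasDerivAt, hg.ae_hasDerivAt] with t hf't hg't ht
  simpa [add_comm] using
    (L.hasFDerivAt_of_bilinear (hf't ht).hasFDerivAt (hg't ht).hasFDerivAt).hasDerivAt

theorem integral_bilin_eq_sub [CompleteSpace E] [CompleteSpace F] [CompleteSpace G]
    (L : E →L[ℝ] F →L[ℝ] G) (hf : IsPrimitiveOn f f' a b) (hg : IsPrimitiveOn g g' a b) :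
    (∫ t in a..b, L (f' t) (g t)) + ∫ t in a..b, L (f t) (g' t) =
      L (f b) (g b) - L (f a) (g a) := by
  rw [(hf.bilin L hg).eq_add_integral b right_mem_uIcc, add_sub_cancel_left,
    intervalIntegral.integral_add
      (intervalIntegrable_bilin_continuousOn L hf.intervalIntegrable hg.continuousOn)]
  exact intervalIntegrable_bilin_continuousOn L.flip hg.intervalIntegrable hf.continuousOn

theorem integral_eq_sub (hf : IsPrimitiveOn f f' a b) : ∫ t in a..b, f' t = f b - f a :=
  eq_sub_of_add_eq' (hf.eq_add_integral b right_mem_uIcc).symm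

end IsPrimitiveOn

theorem ae_eq_zero_of_ae_integral_eq_zero [CompleteSpace E] {g : ℝ → E}
    (hg : IntervalIntegrable g volume a b)
    (h : ∀ᵐ t ∂volume.restrict (Ioo a b), ∫ s in a..t, g s = 0) :
    ∀ᵐ t ∂volume.restrict (Ioo a b), g t = 0 := by
  have hprim := isPrimitiveOn_integral hg 0
  simp only [zero_add] at hprim
  have hsub : Ioo a b ⊆ uIcc a b := Ioo_subset_Icc_self.trans Icc_subset_uIcc
  have hzero : EqOn (fun t => ∫ s in a..t, g s) (fun _ => 0) (Ioo a b) :=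
    Measure.eqOn_open_of_ae_eq h isOpen_Ioo (hprim.continuousOn.mono hsub) continuousOn_const
  filter_upwards [ae_restrict_of_ae hprim.ae_hasDerivAt, ae_restrict_mem measurableSet_Ioo]
    with t hderiv ht
  exact (hderiv (hsub ht)).unique ((hasDerivAt_const t 0).congr_of_eventuallyEq
    (hzero.eventuallyEq_of_mem (isOpen_Ioo.mem_nhds ht)))

end IndefiniteIntegral

section Energy

open Filter Topology

variable {E : Type*} [NormedAddCommGroup E] [InnerProductSpace ℝ E]

local notation "⟪" x ", " y "⟫" => inner ℝ x y

theorem nonneg_of_hasDerivAt_of_eventually_nonneg {k : ℝ → ℝ} {k' t : ℝ} (hk : HasDerivAt k k' t)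
    (hzero : k t = 0) (hnonneg : ∀ᶠ s in 𝓝[>] t, 0 ≤ k s) : 0 ≤ k' := by
  refine ge_of_tendsto ((hasDerivAt_iff_tendsto_slope.1 hk).mono_left
    (nhdsWithin_mono t fun s (hs : s ∈ Ioi t) => ne_of_gt hs)) ?_
  filter_upwards [hnonneg, self_mem_nhdsWithin] with s hs hts
  rw [slope_def_field, hzero, sub_zero]
  exact div_nonneg hs (sub_nonneg.2 (le_of_lt hts))

theorem lipschitzWith_of_norm_sub_le {F : Type*} [SeminormedAddCommGroup F] {B : ℝ → F} {K : ℝ}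
    (hB : ∀ s t, ‖B s - B t‖ ≤ K * |s - t|) : LipschitzWith K.toNNReal B :=
  LipschitzWith.of_dist_le_mul fun s t => by
    rw [dist_eq_norm, Real.dist_eq]
    exact (hB s t).trans (by gcongr; exact Real.le_coe_toNNReal K)

variable {B : ℝ → E →L[ℝ] E} {K : ℝ} {θ θ' : ℝ → ℝ} {w v : ℝ → E}

-- `B` need not be differentiable in operator norm, so the energy is compared from the right with
-- the one in which `B` is frozen at time `t`.
theorem hasDerivAt_energy_le (hB : ∀ s t, ‖B s - B t‖ ≤ K * |s - t|)
    (hsymm : ∀ t x y, ⟪B t x, y⟫ = ⟪x, B t y⟫) (hθ_nonneg : ∀ t, 0 ≤ θ t) {t energy' : ℝ}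
    (hθ : HasDerivAt θ (θ' t) t) (hw : HasDerivAt w (v t) t)
    (henergy : HasDerivAt (fun s => θ s * ⟪B s (w s), w s⟫) energy' t) :
    energy' ≤ θ' t * ⟪B t (w t), w t⟫ + 2 * (θ t * ⟪B t (w t), v t⟫) + K * (θ t * ‖w t‖ ^ 2) := by
  have hfrozen : HasDerivAt (fun s => θ s * ⟪B t (w s), w s⟫)
      (θ' t * ⟪B t (w t), w t⟫ + θ t * (⟪B t (w t), v t⟫ + ⟪B t (v t), w t⟫)) t :=
    hθ.mul (((B t).hasFDerivAt.comp_hasDerivAt t hw).inner ℝ hw)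
  have hdefect : HasDerivAt (fun s => K * (s - t) * (θ s * ‖w s‖ ^ 2))
      (K * 1 * (θ t * ‖w t‖ ^ 2) + K * (t - t) * (θ' t * ‖w t‖ ^ 2 + θ t * (2 * ⟪w t, v t⟫))) t :=
    (((hasDerivAt_id t).sub_const t).const_mul K).mul (hθ.mul hw.norm_sq)
  have hdiff := nonneg_of_hasDerivAt_of_eventually_nonneg ((hfrozen.add hdefect).sub henergy)
    (by simp) (by
      filter_upwards [self_mem_nhdsWithin] with s (hs : t < s)
      have hBst : ⟪(B s - B t) (w s), w s⟫ ≤ K * (s - t) * ‖w s‖ ^ 2 := by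
        rw [sq, ← mul_assoc, ← abs_of_nonneg (sub_nonneg.2 hs.le)]
        exact (real_inner_le_norm _ _).trans
          (mul_le_mul_of_nonneg_right ((B s - B t).le_of_opNorm_le (hB s t) _) (norm_nonneg _))
      have hθBst := mul_le_mul_of_nonneg_left hBst (hθ_nonneg s)
      rw [sub_apply, inner_sub_left] at hθBst
      simp only [Pi.sub_apply, Pi.add_apply]
      linarith)
  rw [hsymm t (v t), real_inner_comm (B t (w t)) (v t), sub_self] at hdiff
  linarith

variable {a b : ℝ}

theorem intervalIntegrable_energy (hB : Continuous B) (hθ : Continuous θ) (hθ' : Continuous θ')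
    (hw : IsPrimitiveOn w v a b) :
    IntervalIntegrable (fun t => θ' t * ⟪B t (w t), w t⟫ + 2 * (θ t * ⟪B t (w t), v t⟫) +
      K * (θ t * ‖w t‖ ^ 2)) volume a b := by
  have hBw : ContinuousOn (fun t => B t (w t)) (uIcc a b) :=
    hB.continuousOn.clm_apply hw.continuousOn
  have hBwv : IntervalIntegrable (fun t => ⟪B t (w t), v t⟫) volume a b :=
    intervalIntegrable_bilin_continuousOn (innerSL ℝ).flip hw.intervalIntegrable hBw
  have hBww : IntervalIntegrable (fun t => θ' t * ⟪B t (w t), w t⟫) volume a b :=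
    (hθ'.continuousOn.mul (hBw.inner hw.continuousOn)).intervalIntegrable
  have hww : IntervalIntegrable (fun t => θ t * ‖w t‖ ^ 2) volume a b :=
    (hθ.continuousOn.mul (hw.continuousOn.norm.pow 2)).intervalIntegrable
  exact (hBww.add ((hBwv.continuousOn_mul hθ.continuousOn).const_mul 2)).add (hww.const_mul K)

theorem energy_sub_le_integral [CompleteSpace E] (hB : ∀ s t, ‖B s - B t‖ ≤ K * |s - t|)
    (hsymm : ∀ t x y, ⟪B t x, y⟫ = ⟪x, B t y⟫) (hθ : ∀ t, HasDerivAt θ (θ' t) t)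
    (hθ' : Continuous θ') (hθ_nonneg : ∀ t, 0 ≤ θ t) (hab : a ≤ b) (hw : IsPrimitiveOn w v a b) :
    θ b * ⟪B b (w b), w b⟫ - θ a * ⟪B a (w a), w a⟫ ≤
      ∫ t in a..b, (θ' t * ⟪B t (w t), w t⟫ + 2 * (θ t * ⟪B t (w t), v t⟫) +
        K * (θ t * ‖w t‖ ^ 2)) := by
  have hwac := hw.absolutelyContinuousOnInterval
  have hBac : AbsolutelyContinuousOnInterval B a b :=
    (lipschitzWith_of_norm_sub_le hB).lipschitzOnWith.absolutelyContinuousOnInterval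
  have hBw : AbsolutelyContinuousOnInterval (fun t => B t (w t)) a b :=
    absolutelyContinuousOnInterval_bilin (ContinuousLinearMap.id ℝ (E →L[ℝ] E)) hBac hwac
  have henergy : AbsolutelyContinuousOnInterval (fun t => θ t * ⟪B t (w t), w t⟫) a b :=
    (isPrimitiveOn_of_hasDerivAt hθ hθ' a b).absolutelyContinuousOnInterval.fun_mul
      (absolutelyContinuousOnInterval_bilin (innerSL ℝ) hBw hwac)
  have hderiv_le : ∀ᵐ t, t ∈ uIcc a b → deriv (fun t => θ t * ⟪B t (w t), w t⟫) t ≤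
      θ' t * ⟪B t (w t), w t⟫ + 2 * (θ t * ⟪B t (w t), v t⟫) + K * (θ t * ‖w t‖ ^ 2) := by
    filter_upwards [henergy.ae_differentiableAt, hw.ae_hasDerivAt] with t hdiff hwt ht
    exact hasDerivAt_energy_le hB hsymm hθ_nonneg (hθ t) (hwt ht) (hdiff ht).hasDerivAt
  rw [← henergy.integral_deriv_eq_sub]
  refine intervalIntegral.integral_mono_ae_restrict hab henergy.intervalIntegrable_deriv
    (intervalIntegrable_energy (lipschitzWith_of_norm_sub_le hB).continuous
      (continuous_iff_continuousAt.2 fun t => (hθ t).continuousAt) hθ' hw) ?_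
  rw [uIcc_of_le hab] at hderiv_le
  exact (ae_restrict_iff' measurableSet_Icc).2 hderiv_le

theorem integral_le_energy_sub [CompleteSpace E] (hB : ∀ s t, ‖B s - B t‖ ≤ K * |s - t|)
    (hsymm : ∀ t x y, ⟪B t x, y⟫ = ⟪x, B t y⟫) (hθ : ∀ t, HasDerivAt θ (θ' t) t)
    (hθ' : Continuous θ') (hθ_nonneg : ∀ t, 0 ≤ θ t) (hab : a ≤ b) (hw : IsPrimitiveOn w v a b) :
    ∫ t in a..b, (θ' t * ⟪B t (w t), w t⟫ + 2 * (θ t * ⟪B t (w t), v t⟫) -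
        K * (θ t * ‖w t‖ ^ 2)) ≤
      θ b * ⟪B b (w b), w b⟫ - θ a * ⟪B a (w a), w a⟫ := by
  have h := energy_sub_le_integral (B := fun t => -B t) (K := K)
    (fun s t => by rw [neg_sub_neg, norm_sub_rev]; exact hB s t)
    (fun t x y => by simp [hsymm]) hθ hθ' hθ_nonneg hab hw
  have hneg : ∀ t, θ' t * ⟪(-B t) (w t), w t⟫ + 2 * (θ t * ⟪(-B t) (w t), v t⟫) +
      K * (θ t * ‖w t‖ ^ 2) = -(θ' t * ⟪B t (w t), w t⟫ + 2 * (θ t * ⟪B t (w t), v t⟫) -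
        K * (θ t * ‖w t‖ ^ 2)) := fun t => by
    simp only [neg_apply, inner_neg_left]
    ring
  rw [intervalIntegral.integral_congr fun t _ => hneg t, intervalIntegral.integral_neg] at h
  simp only [neg_apply, inner_neg_left] at h
  linarith

theorem isPrimitiveOn_mul_norm_sq [CompleteSpace E] (hθ : ∀ t, HasDerivAt θ (θ' t) t)
    (hθ' : Continuous θ') (hw : IsPrimitiveOn w v a b) :
    IsPrimitiveOn (fun t => θ t * ‖w t‖ ^ 2)
      (fun t => θ' t * ‖w t‖ ^ 2 + 2 * (θ t * ⟪w t, v t⟫)) a b := by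
  have hww : IsPrimitiveOn (fun t => ⟪w t, w t⟫) (fun t => ⟪v t, w t⟫ + ⟪w t, v t⟫) a b :=
    hw.bilin (innerSL ℝ) hw
  convert (isPrimitiveOn_of_hasDerivAt hθ hθ' a b).bilin (ContinuousLinearMap.mul ℝ ℝ) hww
    using 2 with t t
  · rw [ContinuousLinearMap.mul_apply', real_inner_self_eq_norm_sq]
  · rw [ContinuousLinearMap.mul_apply', ContinuousLinearMap.mul_apply', real_inner_self_eq_norm_sq,
      real_inner_comm (w t) (v t)]
    ring

end Energy

section WeakDerivative

variable {E : Type*} [NormedAddCommGroup E] [NormedSpace ℝ E] {T : ℝ}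

theorem setIntegral_Ioo_eq_intervalIntegral (hT : 0 ≤ T) (g : ℝ → E) :
    ∫ t in Ioo 0 T, g t = ∫ t in (0 : ℝ)..T, g t := by
  rw [intervalIntegral.integral_of_le hT, integral_Ioc_eq_integral_Ioo]

theorem setIntegral_eq_integral_of_tsupport_subset {X : Type*} [TopologicalSpace X]
    [MeasurableSpace X] {μ : Measure X} {η : X → ℝ} {s : Set X} (hη : tsupport η ⊆ s) (g : X → E) :
    ∫ x in s, η x • g x ∂μ = ∫ x, η x • g x ∂μ :=
  setIntegral_eq_integral_of_forall_compl_eq_zero fun x hx => by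
    rw [image_eq_zero_of_notMem_tsupport fun h => hx (hη h), zero_smul]

theorem ae_eq_zero_of_integral_test_smul_eq_zero [CompleteSpace E] {g : ℝ → E} (hT : 0 ≤ T)
    (hg : IntervalIntegrable g volume 0 T)
    (h : ∀ η : ℝ → ℝ, ContDiff ℝ ∞ η → HasCompactSupport η → tsupport η ⊆ Ioo 0 T →
      ∫ t in (0 : ℝ)..T, η t • g t = 0) :
    ∀ᵐ t ∂volume.restrict (Ioo 0 T), g t = 0 := by
  rw [intervalIntegrable_iff_integrableOn_Ioo_of_le hT] at hg
  rw [ae_restrict_iff' measurableSet_Ioo]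
  refine isOpen_Ioo.ae_eq_zero_of_integral_contDiff_smul_eq_zero hg.locallyIntegrableOn
    fun η hη hη_compact hη_supp => ?_
  rw [← setIntegral_eq_integral_of_tsupport_subset hη_supp, setIntegral_Ioo_eq_intervalIntegral hT]
  exact h η hη hη_compact hη_supp

theorem integral_deriv_smul_primitive [CompleteSpace E] {U g' : ℝ → E} {φ : ℝ → ℝ} {a b : ℝ}
    (hφ : ContDiff ℝ 1 φ) (hU : IsPrimitiveOn U g' a b) :
    (∫ t in a..b, deriv φ t • U t) + ∫ t in a..b, φ t • g' t = φ b • U b - φ a • U a :=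
  (isPrimitiveOn_of_hasDerivAt (fun t => (hφ.differentiable one_ne_zero t).hasDerivAt)
    (hφ.continuous_deriv le_rfl) a b).integral_bilin_eq_sub (ContinuousLinearMap.lsmul ℝ ℝ) hU

theorem intervalIntegrable_smul {g : ℝ → E} {η : ℝ → ℝ} {a b : ℝ}
    (hg : IntervalIntegrable g volume a b) (hη : Continuous η) :
    IntervalIntegrable (fun t => η t • g t) volume a b :=
  hg.continuousOn_smul hη.continuousOn

theorem contDiff_integral {η : ℝ → ℝ} (hη : ContDiff ℝ ∞ η) (a : ℝ) :
    ContDiff ℝ ∞ fun t => ∫ s in a..t, η s :=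
  contDiff_infty_iff_deriv.2
    ⟨fun t => (hη.continuous.integral_hasStrictDerivAt a t).hasDerivAt.differentiableAt, by
      simpa only [funext (hη.continuous.deriv_integral η a)] using hη⟩

/- One-sided weak formulation: test functions need to vanish at `T` only, and the boundary term at
`0` carries the initial value. -/
theorem ae_eq_primitive_of_integral_deriv_smul [CompleteSpace E] {g g' : ℝ → E} {x : E} (hT : 0 ≤ T)
    (hg : IntervalIntegrable g volume 0 T) (hg' : IntervalIntegrable g' volume 0 T)
    (h : ∀ φ : ℝ → ℝ, ContDiff ℝ ∞ φ → φ T = 0 →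
      (∫ t in (0 : ℝ)..T, deriv φ t • g t) + ∫ t in (0 : ℝ)..T, φ t • g' t = -(φ 0 • x)) :
    ∀ᵐ t ∂volume.restrict (Ioo 0 T), g t = x + ∫ s in (0 : ℝ)..t, g' s := by
  have hU := isPrimitiveOn_integral hg' x
  set U : ℝ → E := fun t => x + ∫ s in (0 : ℝ)..t, g' s
  have hUi : IntervalIntegrable U volume 0 T := hU.continuousOn.intervalIntegrable
  have hae := ae_eq_zero_of_integral_test_smul_eq_zero hT (hg.sub hUi) fun η hη _ _ => by
    have hφ := contDiff_integral hη T
    have hgφ := h _ hφ (by simp)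
    have hUφ := integral_deriv_smul_primitive (hφ.of_le (by norm_num)) hU
    simp only [hη.continuous.deriv_integral, intervalIntegral.integral_same, zero_smul,
      zero_sub] at hgφ hUφ
    simp only [smul_sub]
    rw [intervalIntegral.integral_sub (intervalIntegrable_smul hg hη.continuous)
      (intervalIntegrable_smul hUi hη.continuous), sub_eq_zero]
    have hU0 : U 0 = x := by simp [U]
    rw [hU0, ← hgφ] at hUφ
    exact (add_right_cancel hUφ).symm
  filter_upwards [hae] with t ht
  exact sub_eq_zero.1 ht

theorem exists_Icc_of_isCompact_subset_Ioo {s : Set ℝ} {a b : ℝ} (hab : a < b) (hs : IsCompact s)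
    (hsub : s ⊆ Ioo a b) : ∃ c ∈ Ioo a b, ∃ d ∈ Ioo a b, s ⊆ Icc c d := by
  obtain ⟨m, hm⟩ := nonempty_Ioo.2 hab
  have hs' : IsCompact (insert m s) := hs.insert m
  have hsub' : insert m s ⊆ Ioo a b := insert_subset hm hsub
  exact ⟨_, hsub' (hs'.sInf_mem (insert_nonempty m s)), _,
    hsub' (hs'.sSup_mem (insert_nonempty m s)),
    (subset_insert m s).trans (hs'.isBounded.subset_Icc_sInf_sSup)⟩

theorem hasCompactSupport_of_tsupport_subset_Ioo {φ : ℝ → ℝ} {a b : ℝ} (h : tsupport φ ⊆ Ioo a b) :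
    HasCompactSupport φ :=
  isCompact_Icc.of_isClosed_subset (isClosed_tsupport _) (h.trans Ioo_subset_Icc_self)

theorem tsupport_integral_subset_Ioo {ζ : ℝ → ℝ} (hT : 0 < T) (hζ : Continuous ζ)
    (hζ_supp : tsupport ζ ⊆ Ioo 0 T) (hζ_mean : ∫ t in (0 : ℝ)..T, ζ t = 0) :
    tsupport (fun t => ∫ s in (0 : ℝ)..t, ζ s) ⊆ Ioo 0 T := by
  obtain ⟨c, hc, d, hd, hcd⟩ := exists_Icc_of_isCompact_subset_Ioo hT
    (hasCompactSupport_of_tsupport_subset_Ioo hζ_supp) hζ_supp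
  have hζ_zero : ∀ t, t ∉ Icc c d → ζ t = 0 := fun t ht =>
    image_eq_zero_of_notMem_tsupport fun h => ht (hcd h)
  have integral_zero : ∀ x y, (∀ s ∈ uIcc x y, s ∉ Icc c d) → ∫ s in x..y, ζ s = 0 := fun x y h =>
    (intervalIntegral.integral_congr fun s hs => hζ_zero s (h s hs)).trans (by simp)
  have hsupp : Function.support (fun t => ∫ s in (0 : ℝ)..t, ζ s) ⊆ Icc c d := by
    refine Function.support_subset_iff'.2 fun t ht => ?_
    rcases not_and_or.1 ht with htc | htd
    · exact integral_zero 0 t fun s hs hs' =>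
        (max_lt hc.1 (not_le.1 htc)).not_ge (hs'.1.trans hs.2)
    · have hadd := intervalIntegral.integral_add_adjacent_intervals
        (hζ.intervalIntegrable (μ := volume) 0 t) (hζ.intervalIntegrable t T)
      have hzero := integral_zero t T fun s hs hs' =>
        (lt_min (not_le.1 htd) hd.2).not_ge (hs.1.trans hs'.2)
      rwa [hζ_mean, hzero, add_zero] at hadd
  exact (closure_minimal hsupp isClosed_Icc).trans (Icc_subset_Ioo hc.1 hd.2)

theorem exists_test_integral_eq_one (hT : 0 < T) :
    ∃ ρ : ℝ → ℝ, ContDiff ℝ ∞ ρ ∧ tsupport ρ ⊆ Ioo 0 T ∧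
      ∫ t in (0 : ℝ)..T, ρ t = 1 := by
  let bump : ContDiffBump (T / 2) := ⟨T / 8, T / 4, by linarith, by linarith⟩
  have hsupp : tsupport (bump.normed volume) ⊆ Ioo 0 T := by
    rw [bump.tsupport_normed_eq, Real.closedBall_eq_Icc]
    exact Icc_subset_Ioo (show 0 < T / 2 - T / 4 by linarith) (show T / 2 + T / 4 < T by linarith)
  refine ⟨_, bump.contDiff_normed, hsupp, ?_⟩
  rw [← setIntegral_Ioo_eq_intervalIntegral hT.le, ← bump.integral_normed (μ := volume)]
  simpa using setIntegral_eq_integral_of_tsupport_subset (μ := volume) hsupp fun _ => (1 : ℝ)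

/- The du Bois-Reymond lemma: `η - (∫ η) ρ` has mean zero, hence is the derivative of a test
function. -/
theorem exists_ae_eq_const_of_integral_deriv_smul_eq_zero [CompleteSpace E] {g : ℝ → E}
    (hT : 0 < T) (hg : IntervalIntegrable g volume 0 T)
    (h : ∀ φ : ℝ → ℝ, ContDiff ℝ ∞ φ → HasCompactSupport φ → tsupport φ ⊆ Ioo 0 T →
      ∫ t in (0 : ℝ)..T, deriv φ t • g t = 0) :
    ∃ c, ∀ᵐ t ∂volume.restrict (Ioo 0 T), g t = c := by
  obtain ⟨ρ, hρ, hρ_supp, hρ_int⟩ := exists_test_integral_eq_one hT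
  refine ⟨∫ t in (0 : ℝ)..T, ρ t • g t, ?_⟩
  set c := ∫ t in (0 : ℝ)..T, ρ t • g t with hc
  have hae := ae_eq_zero_of_integral_test_smul_eq_zero hT.le
    (hg.sub (intervalIntegrable_const (c := c))) fun η hη _ hη_supp => by
      have hηi := hη.continuous.intervalIntegrable (μ := volume) 0 T
      have hρi := hρ.continuous.intervalIntegrable (μ := volume) 0 T
      set m := ∫ t in (0 : ℝ)..T, η t
      have hζ : ContDiff ℝ ∞ fun t => η t - m * ρ t := hη.sub (contDiff_const.mul hρ)
      have hφ_supp := tsupport_integral_subset_Ioo hT hζ.continuous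
        ((tsupport_sub _ _).trans (union_subset hη_supp
          (tsupport_mul_subset_right.trans hρ_supp)))
        (by rw [intervalIntegral.integral_sub hηi (hρi.const_mul m),
              intervalIntegral.integral_const_mul, hρ_int, mul_one, sub_self])
      have hφ := h _ (contDiff_integral hζ 0) (hasCompactSupport_of_tsupport_subset_Ioo hφ_supp)
        hφ_supp
      have hρg : IntervalIntegrable (fun t => m • ρ t • g t) volume 0 T :=
        (intervalIntegrable_smul hg hρ.continuous).smul m
      simp only [hζ.continuous.deriv_integral, sub_smul, mul_smul] at hφ
      rw [intervalIntegral.integral_sub (intervalIntegrable_smul hg hη.continuous) hρg,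
        intervalIntegral.integral_smul, ← hc] at hφ
      simp only [smul_sub]
      rwa [intervalIntegral.integral_sub (intervalIntegrable_smul hg hη.continuous)
        (intervalIntegrable_smul intervalIntegrable_const hη.continuous),
        intervalIntegral.integral_smul_const]
  filter_upwards [hae] with t ht
  exact sub_eq_zero.1 ht

theorem isWeakDeriv_iff_intervalIntegral {g g' : ℝ → E} (hT : 0 ≤ T) :
    IsWeakDeriv T g g' ↔ ∀ φ : ℝ → ℝ, ContDiff ℝ ∞ φ → HasCompactSupport φ → tsupport φ ⊆ Ioo 0 T →
      ∫ t in (0 : ℝ)..T, deriv φ t • g t = -∫ t in (0 : ℝ)..T, φ t • g' t := by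
  simp only [IsWeakDeriv, setIntegral_Ioo_eq_intervalIntegral hT]

theorem isWeakDeriv_of_isPrimitiveOn [CompleteSpace E] {U g' : ℝ → E} (hT : 0 ≤ T)
    (hU : IsPrimitiveOn U g' 0 T) : IsWeakDeriv T U g' := by
  refine (isWeakDeriv_iff_intervalIntegral hT).2 fun φ hφ _ hφ_supp => ?_
  have hφ_zero : φ 0 = 0 := image_eq_zero_of_notMem_tsupport fun h => (hφ_supp h).1.false
  have hφ_T : φ T = 0 := image_eq_zero_of_notMem_tsupport fun h => (hφ_supp h).2.false
  have hparts := integral_deriv_smul_primitive (hφ.of_le (by norm_num)) hU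
  rw [hφ_zero, hφ_T, zero_smul, zero_smul, sub_zero] at hparts
  exact eq_neg_of_add_eq_zero_left hparts

theorem isWeakDeriv_congr {g k g' : ℝ → E} (h : g =ᵐ[volume.restrict (Ioo 0 T)] k) :
    IsWeakDeriv T g g' ↔ IsWeakDeriv T k g' := by
  have hcongr : ∀ φ : ℝ → ℝ, ∫ t in Ioo 0 T, deriv φ t • g t = ∫ t in Ioo 0 T, deriv φ t • k t :=
    fun φ => integral_congr_ae (h.mono fun t ht => congrArg (deriv φ t • ·) ht)
  simp only [IsWeakDeriv, hcongr]

theorem exists_ae_eq_primitive_of_isWeakDeriv [CompleteSpace E] {g g' : ℝ → E} (hT : 0 < T)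
    (hg : IntervalIntegrable g volume 0 T) (hg' : IntervalIntegrable g' volume 0 T)
    (h : IsWeakDeriv T g g') :
    ∃ c, ∀ᵐ t ∂volume.restrict (Ioo 0 T), g t = c + ∫ s in (0 : ℝ)..t, g' s := by
  have hU := isPrimitiveOn_integral hg' 0
  have hUi := hU.continuousOn.intervalIntegrable (μ := volume)
  obtain ⟨c, hc⟩ := exists_ae_eq_const_of_integral_deriv_smul_eq_zero hT (hg.sub hUi)
    fun φ hφ hφ_compact hφ_supp => by
      have hφ' := hφ.continuous_deriv (by norm_num)
      simp only [smul_sub]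
      rw [intervalIntegral.integral_sub (intervalIntegrable_smul hg hφ')
        (intervalIntegrable_smul hUi hφ'),
        (isWeakDeriv_iff_intervalIntegral hT.le).1 h φ hφ hφ_compact hφ_supp,
        (isWeakDeriv_iff_intervalIntegral hT.le).1 (isWeakDeriv_of_isPrimitiveOn hT.le hU) φ hφ
          hφ_compact hφ_supp, sub_self]
  refine ⟨c, ?_⟩
  filter_upwards [hc] with t ht
  rw [← ht, zero_add, sub_add_cancel]

theorem IsContRep.eqOn {E : Type*} [NormedAddCommGroup E] {g U U' : ℝ → E} (hT : 0 < T)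
    (hU : IsContRep T g U) (hU' : IsContRep T g U') : EqOn U U' (Icc 0 T) := by
  have hae := hU.2.trans hU'.2.symm
  rw [Measure.restrict_congr_set Ioo_ae_eq_Icc] at hae
  exact Measure.eqOn_Icc_of_ae_eq volume hT.ne hae hU.1 hU'.1

theorem isContRep_add_integral {g g' : ℝ → E} {x : E} (hT : 0 ≤ T)
    (hg' : IntervalIntegrable g' volume 0 T)
    (h : ∀ᵐ t ∂volume.restrict (Ioo 0 T), g t = x + ∫ s in (0 : ℝ)..t, g' s) :
    IsContRep T g fun t => x + ∫ s in (0 : ℝ)..t, g' s :=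
  ⟨uIcc_of_le hT ▸ (isPrimitiveOn_integral hg' x).continuousOn, h.mono fun _ ht => ht.symm⟩

theorem isWeakDeriv_and_hasInitialValue_iff [CompleteSpace E] {g g' : ℝ → E} {x : E} (hT : 0 < T)
    (hg : IntervalIntegrable g volume 0 T) (hg' : IntervalIntegrable g' volume 0 T) :
    IsWeakDeriv T g g' ∧ HasInitialValue T g x ↔
      ∀ᵐ t ∂volume.restrict (Ioo 0 T), g t = x + ∫ s in (0 : ℝ)..t, g' s := by
  constructor
  · rintro ⟨hweak, U, hU, rfl⟩
    obtain ⟨c, hc⟩ := exists_ae_eq_primitive_of_isWeakDeriv hT hg hg' hweak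
    have hU0 := hU.eqOn hT (isContRep_add_integral hT.le hg' hc) (left_mem_Icc.2 hT.le)
    simp only [intervalIntegral.integral_same, add_zero] at hU0
    rwa [hU0]
  · intro h
    exact ⟨(isWeakDeriv_congr h).2
      (isWeakDeriv_of_isPrimitiveOn hT.le (isPrimitiveOn_integral hg' x)),
      _, isContRep_add_integral hT.le hg' h, by simp⟩

end WeakDerivative

section Lions

variable {X W : Type*} [NormedAddCommGroup X] [InnerProductSpace ℝ X] [CompleteSpace X]
  [AddCommGroup W] [Module ℝ W]

theorem exists_inner_eq_of_abs_le (P : W →ₗ[ℝ] X) (l : W →ₗ[ℝ] ℝ) {C : ℝ}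
    (h : ∀ w, |l w| ≤ C * ‖P w‖) : ∃ u : X, ∀ w, inner ℝ (P w) u = l w := by
  have hker : LinearMap.ker P ≤ LinearMap.ker l := fun w hw => by
    have hlw := h w
    rw [LinearMap.mem_ker.1 hw, norm_zero, mul_zero] at hlw
    exact LinearMap.mem_ker.2 (abs_nonpos_iff.1 hlw)
  let m : LinearMap.range P →ₗ[ℝ] ℝ :=
    ((LinearMap.ker P).liftQ l hker).comp P.quotKerEquivRange.symm.toLinearMap
  have hm : ∀ w, m ⟨P w, LinearMap.mem_range_self P w⟩ = l w := fun w => by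
    have hsymm : P.quotKerEquivRange.symm ⟨P w, LinearMap.mem_range_self P w⟩ =
        (LinearMap.ker P).mkQ w := P.quotKerEquivRange_symm_apply_image w _
    simp [m, hsymm]
  let M : StrongDual ℝ (LinearMap.range P) := m.mkContinuous C (by
    rintro ⟨_, w, rfl⟩
    exact (congrArg abs (hm w)).le.trans (h w))
  obtain ⟨g, hg, -⟩ := exists_extension_norm_eq (LinearMap.range P) M
  refine ⟨(InnerProductSpace.toDual ℝ X).symm g, fun w => ?_⟩
  rw [real_inner_comm, InnerProductSpace.toDual_symm_apply]
  exact (hg ⟨P w, LinearMap.mem_range_self P w⟩).trans (hm w)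

/- Lions' representation theorem: on the closed space `S` spanned by `ι`, coercivity says that
`l ∘ ι` is controlled by the projection of `Φ` to `S`. -/
theorem exists_mem_closure_range_inner_eq (ι Φ : W →ₗ[ℝ] X) (l : StrongDual ℝ X) {c : ℝ}
    (hc : 0 < c) (hΦ : ∀ w, c * ‖ι w‖ ^ 2 ≤ inner ℝ (Φ w) (ι w)) :
    ∃ u ∈ (LinearMap.range ι).topologicalClosure, ∀ w, inner ℝ (Φ w) u = l (ι w) := by
  set S := (LinearMap.range ι).topologicalClosure
  have : CompleteSpace S := (LinearMap.range ι).isClosed_topologicalClosure.completeSpace_coe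
  let P : W →ₗ[ℝ] S := (S.orthogonalProjectionOnto : X →L[ℝ] S).toLinearMap.comp Φ
  have hι : ∀ w, ι w ∈ S := fun w =>
    (LinearMap.range ι).le_topologicalClosure (LinearMap.mem_range_self ι w)
  have hP : ∀ w (s : S), inner ℝ (P w) s = inner ℝ (Φ w) (s : X) := fun w s =>
    Submodule.inner_orthogonalProjectionOnto_eq_of_mem_right s (Φ w)
  have hcontrol : ∀ w, ‖ι w‖ ≤ c⁻¹ * ‖P w‖ := fun w => by
    rw [inv_mul_eq_div, le_div_iff₀ hc, mul_comm]
    rcases (norm_nonneg (ι w)).eq_or_lt with hzero | hpos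
    · rw [← hzero, mul_zero]
      exact norm_nonneg _
    · refine le_of_mul_le_mul_right ?_ hpos
      calc c * ‖ι w‖ * ‖ι w‖ = c * ‖ι w‖ ^ 2 := by ring
        _ ≤ inner ℝ (P w) (⟨ι w, hι w⟩ : S) := (hΦ w).trans_eq (hP w ⟨ι w, hι w⟩).symm
        _ ≤ ‖P w‖ * ‖ι w‖ := real_inner_le_norm _ _
  obtain ⟨u, hu⟩ := exists_inner_eq_of_abs_le (C := ‖l‖ * c⁻¹) P (l.toLinearMap.comp ι) fun w => by
    rw [mul_assoc]
    exact (l.le_opNorm (ι w)).trans (by gcongr; exact hcontrol w)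
  exact ⟨u, u.2, fun w => (hP w u).symm.trans (hu w)⟩

end Lions

section WaveFamily

variable {V H : Type*} [NormedAddCommGroup V] [InnerProductSpace ℝ V]
  [NormedAddCommGroup H] [InnerProductSpace ℝ H]

local notation "⟪" x ", " y "⟫" => inner ℝ x y

/-- A symmetric, Lipschitz continuous and quasi-coercive family of operators on `V`. Here `V'` is
identified with `V` by the Riesz isomorphism, so that `H → V'` becomes the adjoint of `j`. -/
structure IsWaveFamily (j : V →L[ℝ] H) (A : ℝ → V →L[ℝ] V) (K α κ : ℝ) : Prop where
  lip : ∀ s t, ‖A s - A t‖ ≤ K * |s - t|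
  symm : ∀ t x y, ⟪A t x, y⟫ = ⟪x, A t y⟫
  pos : 0 < α
  coercive : ∀ t x, α * ‖x‖ ^ 2 ≤ ⟪A t x, x⟫ + κ * ‖j x‖ ^ 2

/-- The rate `lam` is so large that the weight `exp (-lam * t)` absorbs all terms of lower order in
the energy estimates. -/
structure IsEnergyRate (j : V →L[ℝ] H) (K α κ lam : ℝ) : Prop where
  shift_le : |κ| + 1 ≤ lam
  lip_le : K + |κ| * ‖j‖ ^ 2 + 1 ≤ lam * α

variable {j : V →L[ℝ] H} {A : ℝ → V →L[ℝ] V} {K α κ lam : ℝ}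

theorem exists_isEnergyRate (j : V →L[ℝ] H) (K κ : ℝ) (hα : 0 < α) :
    ∃ lam, IsEnergyRate j K α κ lam :=
  ⟨max (|κ| + 1) ((K + |κ| * ‖j‖ ^ 2 + 1) / α), le_max_left _ _,
    (div_le_iff₀ hα).1 (le_max_right _ _)⟩

namespace IsWaveFamily

theorem continuous (hA : IsWaveFamily j A K α κ) : Continuous A :=
  (lipschitzWith_of_norm_sub_le hA.lip).continuous

theorem intervalIntegrable_apply (hA : IsWaveFamily j A K α κ) {a b : ℝ} {u : ℝ → V}
    (hu : IntervalIntegrable u volume a b) : IntervalIntegrable (fun t => A t (u t)) volume a b :=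
  intervalIntegrable_bilin_continuousOn (ContinuousLinearMap.id ℝ (V →L[ℝ] V)).flip hu
    hA.continuous.continuousOn

end IsWaveFamily

theorem hasDerivAt_exp_const_mul (r t : ℝ) :
    HasDerivAt (fun t => Real.exp (r * t)) (r * Real.exp (r * t)) t := by
  simpa [mul_comm] using ((hasDerivAt_id t).const_mul r).exp

theorem continuous_exp_const_mul (r : ℝ) : Continuous fun t => Real.exp (r * t) :=
  Real.continuous_exp.comp (continuous_const_mul r)

theorem continuous_const_mul_exp_const_mul (r : ℝ) : Continuous fun t => r * Real.exp (r * t) :=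
  continuous_const.mul (continuous_exp_const_mul r)

theorem intervalIntegrable_exp_mul_norm_sq {E : Type*} [NormedAddCommGroup E] [NormedSpace ℝ E]
    {q p : ℝ → E} {a b : ℝ} (hq : IsPrimitiveOn q p a b) (r : ℝ) :
    IntervalIntegrable (fun t => Real.exp (r * t) * ‖q t‖ ^ 2) volume a b :=
  ContinuousOn.intervalIntegrable
    ((continuous_exp_const_mul r).continuousOn.mul (hq.continuousOn.norm.pow 2))

theorem exp_mul_integral_le {g : ℝ → ℝ} {lam T : ℝ} (hg : Continuous g) (hg0 : ∀ t, 0 ≤ g t)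
    (hlam : 0 ≤ lam) (hT : 0 ≤ T) : Real.exp (-lam * T) * ∫ t in (0 : ℝ)..T, g t ≤
      ∫ t in (0 : ℝ)..T, Real.exp (-lam * t) * g t := by
  have := continuous_exp_const_mul (-lam)
  rw [← intervalIntegral.integral_const_mul]
  refine intervalIntegral.integral_mono_on hT (Continuous.intervalIntegrable (by fun_prop) _ _)
    (Continuous.intervalIntegrable (by fun_prop) _ _) fun t ht => ?_
  exact mul_le_mul_of_nonneg_right
    (Real.exp_le_exp.2 (mul_le_mul_of_nonpos_left ht.2 (neg_nonpos.2 hlam))) (hg0 t)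

theorem two_mul_inner_le_weighted (κ : ℝ) {e : ℝ} (he : 0 < e) (x y : H) :
    2 * κ * ⟪x, y⟫ ≤ |κ| * (e * ‖x‖ ^ 2 + e⁻¹ * ‖y‖ ^ 2) := by
  have young : 2 * (‖x‖ * ‖y‖) ≤ e * ‖x‖ ^ 2 + e⁻¹ * ‖y‖ ^ 2 := by
    have hsq := mul_nonneg he.le (sq_nonneg (‖x‖ - e⁻¹ * ‖y‖))
    have hexpand : e * (‖x‖ - e⁻¹ * ‖y‖) ^ 2 =
        e * ‖x‖ ^ 2 + e⁻¹ * ‖y‖ ^ 2 - 2 * (‖x‖ * ‖y‖) := by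
      field_simp
      ring
    linarith
  calc 2 * κ * ⟪x, y⟫ ≤ |2 * κ * ⟪x, y⟫| := le_abs_self _
    _ = |κ| * (2 * |⟪x, y⟫|) := by rw [abs_mul, abs_mul, abs_two]; ring
    _ ≤ |κ| * (2 * (‖x‖ * ‖y‖)) := by gcongr; exact abs_real_inner_le_norm x y
    _ ≤ _ := by gcongr

variable [CompleteSpace V] [CompleteSpace H]

/-- The coercive family `A + κ j* j`. -/
noncomputable def coerciveShift (j : V →L[ℝ] H) (A : ℝ → V →L[ℝ] V) (κ t : ℝ) :
    V →L[ℝ] V :=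
  A t + κ • (j.adjoint ∘L j)

theorem inner_coerciveShift (t : ℝ) (x y : V) :
    ⟪coerciveShift j A κ t x, y⟫ = ⟪A t x, y⟫ + κ * ⟪j x, j y⟫ := by
  simp [coerciveShift, inner_add_left, inner_smul_left, ContinuousLinearMap.adjoint_inner_left]

namespace IsWaveFamily

theorem coerciveShift_lip (hA : IsWaveFamily j A K α κ) (s t : ℝ) :
    ‖coerciveShift j A κ s - coerciveShift j A κ t‖ ≤ K * |s - t| := by
  simpa [coerciveShift] using hA.lip s t

theorem continuous_coerciveShift (hA : IsWaveFamily j A K α κ) : Continuous (coerciveShift j A κ) :=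
  (lipschitzWith_of_norm_sub_le hA.coerciveShift_lip).continuous

theorem coerciveShift_symm (hA : IsWaveFamily j A K α κ) (t : ℝ) (x y : V) :
    ⟪coerciveShift j A κ t x, y⟫ = ⟪x, coerciveShift j A κ t y⟫ := by
  rw [← real_inner_comm x, inner_coerciveShift, inner_coerciveShift, hA.symm,
    real_inner_comm x, real_inner_comm (j x)]

theorem le_inner_coerciveShift (hA : IsWaveFamily j A K α κ) (t : ℝ) (x : V) :
    α * ‖x‖ ^ 2 ≤ ⟪coerciveShift j A κ t x, x⟫ := by
  rw [inner_coerciveShift, real_inner_self_eq_norm_sq]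
  exact hA.coercive t x

theorem inner_coerciveShift_nonneg (hA : IsWaveFamily j A K α κ) (t : ℝ) (x : V) :
    0 ≤ ⟪coerciveShift j A κ t x, x⟫ :=
  (mul_nonneg hA.pos.le (sq_nonneg _)).trans (hA.le_inner_coerciveShift t x)

end IsWaveFamily

theorem lower_order_le (hA : IsWaveFamily j A K α κ) (hlam : IsEnergyRate j K α κ lam) {e : ℝ}
    (he : 0 < e) (t : ℝ) (x : V) (h : H) :
    e * ‖x‖ ^ 2 + e⁻¹ * ‖h‖ ^ 2 + 2 * κ * ⟪h, j x⟫ + K * (e * ‖x‖ ^ 2) ≤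
      lam * (e * ⟪coerciveShift j A κ t x, x⟫ + e⁻¹ * ‖h‖ ^ 2) := by
  have hcross := two_mul_inner_le_weighted κ he (j x) h
  rw [real_inner_comm] at hcross
  have hjx : |κ| * (e * ‖j x‖ ^ 2) ≤ |κ| * (e * (‖j‖ ^ 2 * ‖x‖ ^ 2)) := by
    rw [← mul_pow]
    gcongr
    exact j.le_opNorm x
  have hx : (K + |κ| * ‖j‖ ^ 2 + 1) * (e * ‖x‖ ^ 2) ≤ lam * α * (e * ‖x‖ ^ 2) :=
    mul_le_mul_of_nonneg_right hlam.lip_le (by positivity)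
  have hh : (|κ| + 1) * (e⁻¹ * ‖h‖ ^ 2) ≤ lam * (e⁻¹ * ‖h‖ ^ 2) :=
    mul_le_mul_of_nonneg_right hlam.shift_le (by positivity)
  have hcoercive : lam * (e * (α * ‖x‖ ^ 2)) ≤ lam * (e * ⟪coerciveShift j A κ t x, x⟫) :=
    mul_le_mul_of_nonneg_left (mul_le_mul_of_nonneg_left (hA.le_inner_coerciveShift t x) he.le)
      ((by positivity : 0 ≤ |κ| + 1).trans hlam.shift_le)
  linarith

end WaveFamily

section Uniqueness

variable {V H : Type*} [NormedAddCommGroup V] [InnerProductSpace ℝ V] [CompleteSpace V]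
  [NormedAddCommGroup H] [InnerProductSpace ℝ H] [CompleteSpace H]

local notation "⟪" x ", " y "⟫" => inner ℝ x y

theorem intervalIntegrable_clm_comp {E F : Type*} [NormedAddCommGroup E] [NormedSpace ℝ E]
    [NormedAddCommGroup F] [NormedSpace ℝ F] (L : E →L[ℝ] F) {g : ℝ → E} {a b : ℝ}
    (hg : IntervalIntegrable g volume a b) : IntervalIntegrable (fun t => L (g t)) volume a b :=
  ⟨L.integrable_comp hg.1, L.integrable_comp hg.2⟩

theorem intervalIntegrable_of_memLp_two {E : Type*} [NormedAddCommGroup E] {T : ℝ} (hT : 0 ≤ T)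
    {g : ℝ → E} (hg : MemLp g 2 (volume.restrict (Ioo 0 T))) : IntervalIntegrable g volume 0 T :=
  (intervalIntegrable_iff_integrableOn_Ioo_of_le hT).2 (hg.integrable one_le_two)

theorem integral_sub_of_mem_Ioo {E : Type*} [NormedAddCommGroup E] [NormedSpace ℝ E] {T t : ℝ}
    {g g' : ℝ → E} (hg : IntervalIntegrable g volume 0 T) (hg' : IntervalIntegrable g' volume 0 T)
    (ht : t ∈ Ioo 0 T) :
    ∫ s in (0 : ℝ)..t, (g s - g' s) = (∫ s in (0 : ℝ)..t, g s) - ∫ s in (0 : ℝ)..t, g' s :=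
  have hsub : uIcc 0 t ⊆ uIcc 0 T :=
    uIcc_subset_uIcc_left (mem_uIcc_of_le ht.1.le ht.2.le)
  intervalIntegral.integral_sub (hg.mono_set hsub) (hg'.mono_set hsub)

/-- The wave equation integrated in time: `p` is the velocity `u̇`, and the equations are those of
`IsWaveSolution` under the identification of `V'` with `V`. -/
structure IsMildSolution (j : V →L[ℝ] H) (A : ℝ → V →L[ℝ] V) (T : ℝ) (u₀ : V) (u₁ : H)
    (f : ℝ → H) (u : ℝ → V) (p : ℝ → H) : Prop where
  memLp_fst : MemLp u 2 (volume.restrict (Ioo 0 T))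
  memLp_snd : MemLp p 2 (volume.restrict (Ioo 0 T))
  first : ∀ᵐ t ∂volume.restrict (Ioo 0 T), j (u t) = j u₀ + ∫ s in (0 : ℝ)..t, p s
  second : ∀ᵐ t ∂volume.restrict (Ioo 0 T), j.adjoint (p t) =
    j.adjoint u₁ + ∫ s in (0 : ℝ)..t, (j.adjoint (f s) - A s (u s))

variable {j : V →L[ℝ] H} {A : ℝ → V →L[ℝ] V} {K α κ lam T : ℝ} {u₀ : V} {u₁ : H} {f p p' : ℝ → H}
  {u u' w v : ℝ → V} {q : ℝ → H}

theorem intervalIntegrable_backward_energy (hA : IsWaveFamily j A K α κ)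
    (hw : IsPrimitiveOn w v 0 T) :
    IntervalIntegrable (fun t => lam * Real.exp (lam * t) * ⟪coerciveShift j A κ t (w t), w t⟫ +
      2 * (Real.exp (lam * t) * ⟪coerciveShift j A κ t (w t), v t⟫) -
        K * (Real.exp (lam * t) * ‖w t‖ ^ 2)) volume 0 T := by
  simpa only [neg_mul, ← sub_eq_add_neg] using intervalIntegrable_energy (K := -K)
    hA.continuous_coerciveShift (continuous_exp_const_mul lam)
    (continuous_const_mul_exp_const_mul lam) hw

theorem integral_backward_energy_nonpos (hA : IsWaveFamily j A K α κ) (hT : 0 ≤ T)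
    (hw : IsPrimitiveOn w v 0 T) (hwT : w T = 0) :
    ∫ t in (0 : ℝ)..T, (lam * Real.exp (lam * t) * ⟪coerciveShift j A κ t (w t), w t⟫ +
      2 * (Real.exp (lam * t) * ⟪coerciveShift j A κ t (w t), v t⟫) -
        K * (Real.exp (lam * t) * ‖w t‖ ^ 2)) ≤ 0 := by
  refine (integral_le_energy_sub hA.coerciveShift_lip hA.coerciveShift_symm
    (hasDerivAt_exp_const_mul lam) (continuous_const_mul_exp_const_mul lam)
    (fun t => (Real.exp_pos _).le) hT hw).trans ?_
  rw [hwT, inner_zero_right, mul_zero, zero_sub, neg_nonpos]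
  exact mul_nonneg (Real.exp_pos _).le (hA.inner_coerciveShift_nonneg 0 _)

theorem integral_forward_norm_sq_nonneg (hq : IsPrimitiveOn q p 0 T) (hq0 : q 0 = 0) (r : ℝ) :
    0 ≤ ∫ t in (0 : ℝ)..T, (r * Real.exp (r * t) * ‖q t‖ ^ 2 +
      2 * (Real.exp (r * t) * ⟪q t, p t⟫)) := by
  rw [(isPrimitiveOn_mul_norm_sq (hasDerivAt_exp_const_mul r)
    (continuous_const_mul_exp_const_mul r) hq).integral_eq_sub, hq0]
  simp only [norm_zero, ne_eq, OfNat.ofNat_ne_zero, not_false_eq_true, zero_pow, mul_zero, sub_zero]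
  positivity

theorem weighted_norm_sq_le (hA : IsWaveFamily j A K α κ) (hlam : IsEnergyRate j K α κ lam) {e : ℝ}
    (he : 0 < e) (t : ℝ) (x y : V) (h : H) :
    e⁻¹ * ‖j y‖ ^ 2 ≤
      (lam * e * ⟪coerciveShift j A κ t x, x⟫ + 2 * (e * ⟪coerciveShift j A κ t x, e⁻¹ • y⟫) -
        K * (e * ‖x‖ ^ 2)) - (-lam * e⁻¹ * ‖j y‖ ^ 2 + 2 * (e⁻¹ * ⟪j y, h⟫)) +
      2 * (⟪-A t y, x⟫ + ⟪j.adjoint h, e⁻¹ • y⟫) := by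
  have hlower := lower_order_le hA hlam he t x (-j y)
  have hx : 0 ≤ e * ‖x‖ ^ 2 := by positivity
  have hshift : e * ⟪coerciveShift j A κ t x, e⁻¹ • y⟫ = ⟪A t y, x⟫ + κ * ⟪j y, j x⟫ := by
    rw [inner_smul_right, mul_inv_cancel_left₀ he.ne', hA.coerciveShift_symm, real_inner_comm,
      inner_coerciveShift]
  have hadjoint : ⟪j.adjoint h, e⁻¹ • y⟫ = e⁻¹ * ⟪j y, h⟫ := by
    rw [inner_smul_right, ContinuousLinearMap.adjoint_inner_left, real_inner_comm]
  rw [norm_neg, inner_neg_left] at hlower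
  rw [hshift, hadjoint, inner_neg_left]
  linarith

namespace IsMildSolution

theorem integral_exp_mul_norm_sq_nonpos (hA : IsWaveFamily j A K α κ)
    (hlam : IsEnergyRate j K α κ lam) (hT : 0 ≤ T) (h : IsMildSolution j A T 0 0 0 u p) :
    ∫ t in (0 : ℝ)..T, Real.exp (-lam * t) * ‖∫ s in (0 : ℝ)..t, p s‖ ^ 2 ≤ 0 := by
  have hu := intervalIntegrable_of_memLp_two hT h.memLp_fst
  have hv := intervalIntegrable_smul hu (continuous_exp_const_mul (-lam))
  have hw := isPrimitiveOn_integral hv (-∫ s in (0 : ℝ)..T, Real.exp (-lam * s) • u s)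
  have hq := isPrimitiveOn_integral (intervalIntegrable_of_memLp_two hT h.memLp_snd) 0
  have hG := isPrimitiveOn_integral (hA.intervalIntegrable_apply hu).neg 0
  simp only [zero_add, Pi.neg_apply] at hq hG
  set w : ℝ → V := fun t => -(∫ s in (0 : ℝ)..T, Real.exp (-lam * s) • u s) +
    ∫ s in (0 : ℝ)..t, Real.exp (-lam * s) • u s
  have hwT : w T = 0 := neg_add_cancel _
  have hbackward := integral_backward_energy_nonpos (lam := lam) hA hT hw hwT
  have hforward := integral_forward_norm_sq_nonneg hq (by simp) (-lam)
  have hweak : (∫ t in (0 : ℝ)..T, ⟪-A t (u t), w t⟫) +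
      ∫ t in (0 : ℝ)..T, ⟪∫ s in (0 : ℝ)..t, -A s (u s), Real.exp (-lam * t) • u t⟫ = 0 :=
    (hG.integral_bilin_eq_sub (innerSL ℝ) hw).trans (by simp [hwT])
  have hbackward_int := intervalIntegrable_backward_energy (lam := lam) hA hw
  have hforward_int := (isPrimitiveOn_mul_norm_sq (hasDerivAt_exp_const_mul (-lam))
    (continuous_const_mul_exp_const_mul (-lam)) hq).intervalIntegrable
  have hAuw_int : IntervalIntegrable (fun t => ⟪-A t (u t), w t⟫) volume 0 T :=
    intervalIntegrable_bilin_continuousOn (innerSL ℝ) hG.intervalIntegrable hw.continuousOn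
  have hGv_int : IntervalIntegrable
      (fun t => ⟪∫ s in (0 : ℝ)..t, -A s (u s), Real.exp (-lam * t) • u t⟫) volume 0 T :=
    intervalIntegrable_bilin_continuousOn (innerSL ℝ).flip hv hG.continuousOn
  have hweak_int := (hAuw_int.add hGv_int).const_mul 2
  have hle := intervalIntegral.integral_mono_ae_restrict hT
    (intervalIntegrable_exp_mul_norm_sq hq (-lam))
    ((hbackward_int.sub hforward_int).add hweak_int) (by
      rw [← Measure.restrict_congr_set Ioo_ae_eq_Icc]
      filter_upwards [h.first, h.second] with t hfirst hsecond
      simp only [map_zero, zero_add, Pi.zero_apply, zero_sub] at hfirst hsecond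
      rw [← hfirst, ← hsecond, neg_mul lam t, Real.exp_neg]
      exact weighted_norm_sq_le hA hlam (Real.exp_pos (lam * t)) t (w t) (u t) (p t))
  rw [intervalIntegral.integral_add (hbackward_int.sub hforward_int) hweak_int,
    intervalIntegral.integral_sub hbackward_int hforward_int, intervalIntegral.integral_const_mul,
    intervalIntegral.integral_add hAuw_int hGv_int, hweak] at hle
  linarith

theorem ae_map_eq_zero (hA : IsWaveFamily j A K α κ) (hT : 0 ≤ T)
    (h : IsMildSolution j A T 0 0 0 u p) : ∀ᵐ t ∂volume.restrict (Ioo 0 T), j (u t) = 0 := by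
  obtain ⟨lam, hlam⟩ := exists_isEnergyRate j K κ hA.pos
  have hq := isPrimitiveOn_integral (intervalIntegrable_of_memLp_two hT h.memLp_snd) 0
  simp only [zero_add] at hq
  have hnonneg : 0 ≤ᵐ[volume.restrict (Ioc 0 T)]
      fun t => Real.exp (-lam * t) * ‖∫ s in (0 : ℝ)..t, p s‖ ^ 2 :=
    Filter.Eventually.of_forall fun t => by positivity
  have hzero := (intervalIntegral.integral_eq_zero_iff_of_le_of_nonneg_ae hT hnonneg
    (intervalIntegrable_exp_mul_norm_sq hq (-lam))).1
    (le_antisymm (h.integral_exp_mul_norm_sq_nonpos hA hlam hT)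
      (intervalIntegral.integral_nonneg_of_ae_restrict hT (by
        rwa [← Measure.restrict_congr_set Ioc_ae_eq_Icc])))
  rw [← Measure.restrict_congr_set Ioo_ae_eq_Ioc] at hzero
  filter_upwards [h.first, hzero] with t hfirst ht
  rw [hfirst, map_zero, zero_add]
  simpa [(Real.exp_pos _).ne'] using ht

theorem ae_eq_zero (hA : IsWaveFamily j A K α κ) (hT : 0 ≤ T)
    (h : IsMildSolution j A T 0 0 0 u p) : ∀ᵐ t ∂volume.restrict (Ioo 0 T), u t = 0 := by
  have hju := h.ae_map_eq_zero hA hT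
  have hp := ae_eq_zero_of_ae_integral_eq_zero (intervalIntegrable_of_memLp_two hT h.memLp_snd) (by
    filter_upwards [h.first, hju] with t hfirst ht
    rw [← ht, hfirst, map_zero, zero_add])
  have hAu := ae_eq_zero_of_ae_integral_eq_zero
    (hA.intervalIntegrable_apply (intervalIntegrable_of_memLp_two hT h.memLp_fst)) (by
      filter_upwards [h.second, hp] with t hsecond ht
      simpa [ht] using hsecond)
  filter_upwards [hju, hAu] with t hjut hAut
  have hnorm := hA.coercive t (u t)
  rw [hjut, hAut, inner_zero_left, norm_zero, zero_pow two_ne_zero, mul_zero, add_zero] at hnorm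
  exact norm_eq_zero.1 (pow_eq_zero_iff two_ne_zero |>.1
    (le_antisymm (nonpos_of_mul_nonpos_right hnorm hA.pos) (sq_nonneg _)))

theorem sub (hA : IsWaveFamily j A K α κ) (hT : 0 ≤ T) (hf : IntervalIntegrable f volume 0 T)
    (h : IsMildSolution j A T u₀ u₁ f u p) (h' : IsMildSolution j A T u₀ u₁ f u' p') :
    IsMildSolution j A T 0 0 0 (fun t => u t - u' t) (fun t => p t - p' t) := by
  have hp := intervalIntegrable_of_memLp_two hT h.memLp_snd
  have hp' := intervalIntegrable_of_memLp_two hT h'.memLp_snd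
  have hjf := intervalIntegrable_clm_comp j.adjoint hf
  have hAu := hjf.sub (hA.intervalIntegrable_apply (intervalIntegrable_of_memLp_two hT h.memLp_fst))
  have hAu' :=
    hjf.sub (hA.intervalIntegrable_apply (intervalIntegrable_of_memLp_two hT h'.memLp_fst))
  refine ⟨h.memLp_fst.sub h'.memLp_fst, h.memLp_snd.sub h'.memLp_snd, ?_, ?_⟩
  · filter_upwards [h.first, h'.first, ae_restrict_mem measurableSet_Ioo] with t h1 h2 ht
    rw [map_sub, h1, h2, integral_sub_of_mem_Ioo hp hp' ht, map_zero]
    abel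
  · filter_upwards [h.second, h'.second, ae_restrict_mem measurableSet_Ioo] with t h1 h2 ht
    rw [map_sub, h1, h2, add_sub_add_left_eq_sub, ← integral_sub_of_mem_Ioo hAu hAu' ht, map_zero,
      zero_add]
    refine intervalIntegral.integral_congr fun s _ => ?_
    simp only [Pi.zero_apply, map_zero, map_sub, zero_sub, sub_sub_sub_cancel_left, neg_sub]

theorem ae_eq (hA : IsWaveFamily j A K α κ) (hT : 0 ≤ T) (hf : IntervalIntegrable f volume 0 T)
    (h : IsMildSolution j A T u₀ u₁ f u p) (h' : IsMildSolution j A T u₀ u₁ f u' p') :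
    ∀ᵐ t ∂volume.restrict (Ioo 0 T), u t = u' t := by
  filter_upwards [(h.sub hA hT hf h').ae_eq_zero hA hT] with t ht
  exact sub_eq_zero.1 ht

theorem isContRep (hT : 0 ≤ T) (h : IsMildSolution j A T u₀ u₁ f u p) :
    IsContRep T (fun t => j (u t)) fun t => j u₀ + ∫ s in (0 : ℝ)..t, p s :=
  isContRep_add_integral hT (intervalIntegrable_of_memLp_two hT h.memLp_snd) h.first

theorem mono {s : ℝ} (hsT : s ≤ T) (h : IsMildSolution j A T u₀ u₁ f u p) :
    IsMildSolution j A s u₀ u₁ f u p := by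
  have hle : volume.restrict (Ioo 0 s) ≤ volume.restrict (Ioo 0 T) :=
    Measure.restrict_mono (Ioo_subset_Ioo_right hsT) le_rfl
  exact ⟨h.memLp_fst.mono_measure hle, h.memLp_snd.mono_measure hle, ae_mono hle h.first,
    ae_mono hle h.second⟩

end IsMildSolution

end Uniqueness

section ContinuousToL2

variable {E F : Type*} [NormedAddCommGroup E] [NormedAddCommGroup F] {T : ℝ}

theorem memLp_two_of_continuous {g : ℝ → E} (hg : Continuous g) (T : ℝ) :
    MemLp g 2 (volume.restrict (Ioo 0 T)) := by
  obtain ⟨C, hC⟩ := (isCompact_Icc (a := (0 : ℝ)) (b := T)).exists_bound_of_continuousOn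
    hg.continuousOn
  refine MemLp.of_bound hg.aestronglyMeasurable C ?_
  filter_upwards [ae_restrict_mem measurableSet_Ioo] with t ht using hC t (Ioo_subset_Icc_self ht)

theorem memLp_two_bilin_of_continuous [NormedSpace ℝ E] [NormedSpace ℝ F] {G : Type*}
    [NormedAddCommGroup G] [NormedSpace ℝ G] (L : E →L[ℝ] F →L[ℝ] G) {f : ℝ → E}
    (hf : Continuous f) {g : ℝ → F} (hg : MemLp g 2 (volume.restrict (Ioo 0 T))) :
    MemLp (fun t => L (f t) (g t)) 2 (volume.restrict (Ioo 0 T)) := by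
  obtain ⟨C, hC⟩ := (isCompact_Icc (a := (0 : ℝ)) (b := T)).exists_bound_of_continuousOn
    hf.continuousOn
  refine hg.of_le_mul (c := ‖L‖ * C) (L.aestronglyMeasurable_comp₂ hf.aestronglyMeasurable hg.1) ?_
  filter_upwards [ae_restrict_mem measurableSet_Ioo] with t ht
  exact L.le_of_opNorm₂_le_of_le le_rfl (hC t (Ioo_subset_Icc_self ht)) le_rfl

/-- The class in `L²(0,T;E)` of a continuous function on the line. -/
noncomputable def continuousToL2 [NormedSpace ℝ E] (T : ℝ) : C(ℝ, E) →ₗ[ℝ] L2 T E where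
  toFun g := (memLp_two_of_continuous g.continuous T).toLp g
  map_add' _ _ := rfl
  map_smul' _ _ := rfl

theorem coeFn_continuousToL2 [NormedSpace ℝ E] (g : C(ℝ, E)) :
    continuousToL2 T g =ᵐ[volume.restrict (Ioo 0 T)] g :=
  (memLp_two_of_continuous g.continuous T).coeFn_toLp

theorem inner_continuousToL2 [InnerProductSpace ℝ E] (hT : 0 ≤ T) (g : C(ℝ, E)) (k : L2 T E) :
    inner ℝ (continuousToL2 T g) k = ∫ t in (0 : ℝ)..T, inner ℝ (g t) (k t) := by
  rw [L2.inner_def, ← setIntegral_Ioo_eq_intervalIntegral hT]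
  refine integral_congr_ae ?_
  filter_upwards [coeFn_continuousToL2 g] with t ht
  rw [ht]

theorem norm_sq_continuousToL2 [InnerProductSpace ℝ E] (hT : 0 ≤ T) (g : C(ℝ, E)) :
    ‖continuousToL2 T g‖ ^ 2 = ∫ t in (0 : ℝ)..T, ‖g t‖ ^ 2 := by
  rw [← real_inner_self_eq_norm_sq, inner_continuousToL2 hT,
    ← setIntegral_Ioo_eq_intervalIntegral hT, ← setIntegral_Ioo_eq_intervalIntegral hT]
  refine integral_congr_ae ?_
  filter_upwards [coeFn_continuousToL2 g] with t ht
  rw [ht, real_inner_self_eq_norm_sq]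

/-- The integral against a continuous scalar weight, as an operator on `L²(0,T;E)`. -/
noncomputable def weightedIntegral [NormedSpace ℝ E] [CompleteSpace E] (T : ℝ) (φ : C(ℝ, ℝ)) :
    L2 T E →L[ℝ] E :=
  (ContinuousLinearMap.lsmul ℝ ℝ).lpPairing (volume.restrict (Ioo 0 T)) 2 2 (continuousToL2 T φ)

theorem weightedIntegral_apply [NormedSpace ℝ E] [CompleteSpace E] (hT : 0 ≤ T) (φ : C(ℝ, ℝ))
    (g : L2 T E) : weightedIntegral T φ g = ∫ t in (0 : ℝ)..T, φ t • g t := by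
  rw [weightedIntegral, ContinuousLinearMap.lpPairing_eq_integral,
    ← setIntegral_Ioo_eq_intervalIntegral hT]
  refine integral_congr_ae ?_
  filter_upwards [coeFn_continuousToL2 φ] with t ht
  rw [ht, ContinuousLinearMap.lsmul_apply]

theorem weightedIntegral_continuousToL2 [NormedSpace ℝ E] [CompleteSpace E] (hT : 0 ≤ T)
    (φ : C(ℝ, ℝ)) (g : C(ℝ, E)) :
    weightedIntegral T φ (continuousToL2 T g) = ∫ t in (0 : ℝ)..T, φ t • g t := by
  rw [weightedIntegral_apply hT, ← setIntegral_Ioo_eq_intervalIntegral hT,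
    ← setIntegral_Ioo_eq_intervalIntegral hT]
  refine integral_congr_ae ?_
  filter_upwards [coeFn_continuousToL2 g] with t ht
  rw [ht]

/-- Pointwise application of a continuous family of operators. -/
noncomputable def applyFamily [NormedSpace ℝ E] [NormedSpace ℝ F] (L : C(ℝ, E →L[ℝ] F)) :
    C(ℝ, E) →ₗ[ℝ] C(ℝ, F) where
  toFun g := ⟨fun t => L t (g t), L.continuous.clm_apply g.continuous⟩
  map_add' _ _ := by ext; simp
  map_smul' _ _ := by ext; simp

end ContinuousToL2

section TestFunctions

variable {V H : Type*} [NormedAddCommGroup V] [InnerProductSpace ℝ V]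
  [NormedAddCommGroup H] [InnerProductSpace ℝ H]

local notation "⟪" x ", " y "⟫" => inner ℝ x y

variable (V) in
/-- The triples `(w, w', w'')` of a `C²` function and its derivatives such that `w' T = 0`. -/
def testSpace (T : ℝ) : Submodule ℝ (C(ℝ, V) × C(ℝ, V) × C(ℝ, V)) where
  carrier := {w | (∀ t, HasDerivAt w.1 (w.2.1 t) t) ∧ (∀ t, HasDerivAt w.2.1 (w.2.2 t) t) ∧
    w.2.1 T = 0}
  add_mem' := fun h k => ⟨fun t => (h.1 t).add (k.1 t), fun t => (h.2.1 t).add (k.2.1 t), by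
    simp [h.2.2, k.2.2]⟩
  zero_mem' := ⟨fun t => hasDerivAt_const t 0, fun t => hasDerivAt_const t 0, rfl⟩
  smul_mem' := fun c _ h => ⟨fun t => (h.1 t).const_smul c, fun t => (h.2.1 t).const_smul c, by
    simp [h.2.2]⟩

variable (V H) in
/-- The Hilbert space in which the variational problem is posed. Its elements collect `u`, `u̇`,
`u 0`, `u T` and `u̇ 0`. -/
abbrev TrajectorySpace (T : ℝ) :=
  WithLp 2 (WithLp 2 (L2 T V × L2 T H) × WithLp 2 (V × WithLp 2 (V × H)))

variable {j : V →L[ℝ] H} {A : ℝ → V →L[ℝ] V} {K α κ lam T : ℝ}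

/-- The embedding of the test functions into the space of trajectories, `j ẇ` playing the role of
`u̇`. -/
noncomputable def trajectory (j : V →L[ℝ] H) (T : ℝ) :
    testSpace V T →ₗ[ℝ] TrajectorySpace V H T where
  toFun w := .toLp 2 (.toLp 2 (continuousToL2 T w.1.1,
      continuousToL2 T (applyFamily (.const ℝ j) w.1.2.1)),
    .toLp 2 (w.1.1 0, .toLp 2 (w.1.1 T, j (w.1.2.1 0))))
  map_add' w k := by
    simp only [Submodule.coe_add, Prod.fst_add, Prod.snd_add, ContinuousMap.add_apply, map_add]
    rfl
  map_smul' c w := by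
    simp only [Submodule.coe_smul, Prod.smul_fst, Prod.smul_snd, ContinuousMap.smul_apply, map_smul]
    rfl

theorem norm_sq_trajectory (hT : 0 ≤ T) (w : testSpace V T) :
    ‖trajectory j T w‖ ^ 2 = (∫ t in (0 : ℝ)..T, ‖w.1.1 t‖ ^ 2) +
      (∫ t in (0 : ℝ)..T, ‖j (w.1.2.1 t)‖ ^ 2) +
      (‖w.1.1 0‖ ^ 2 + (‖w.1.1 T‖ ^ 2 + ‖j (w.1.2.1 0)‖ ^ 2)) := by
  simp only [trajectory, LinearMap.coe_mk, AddHom.coe_mk, WithLp.prod_norm_sq_eq_of_L2,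
    WithLp.toLp_fst, WithLp.toLp_snd, norm_sq_continuousToL2 hT]
  rfl

variable [CompleteSpace V] [CompleteSpace H]

/-- The left-hand side of the variational problem: the wave operator tested with
`exp (-lam * t) • ẇ` and integrated by parts once, plus the energy pairing of the values at `0`. -/
noncomputable def dualTrajectory (j : V →L[ℝ] H) (hA : Continuous A) (κ lam T : ℝ) :
    testSpace V T →ₗ[ℝ] TrajectorySpace V H T where
  toFun w := .toLp 2 (.toLp 2
    (continuousToL2 T (applyFamily
      ⟨fun t => Real.exp (-lam * t) • A t, (continuous_exp_const_mul (-lam)).smul hA⟩ w.1.2.1),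
    continuousToL2 T (applyFamily
      ⟨fun t => Real.exp (-lam * t) • j, (continuous_exp_const_mul (-lam)).smul continuous_const⟩
      (lam • w.1.2.1 - w.1.2.2))), .toLp 2 (coerciveShift j A κ 0 (w.1.1 0), 0))
  map_add' w k := by
    rw [← WithLp.toLp_add, Prod.mk_add_mk, ← WithLp.toLp_add, ← WithLp.toLp_add, Prod.mk_add_mk,
      Prod.mk_add_mk, add_zero, ← map_add, ← map_add, ← map_add, ← map_add, ← map_add]
    congr 6
    simp only [Submodule.coe_add, Prod.fst_add, Prod.snd_add, smul_add]
    abel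
  map_smul' c w := by
    simp only [Submodule.coe_smul, Prod.smul_fst, Prod.smul_snd, ContinuousMap.smul_apply, map_smul,
      smul_comm lam c, ← smul_sub]
    rw [RingHom.id_apply, ← WithLp.toLp_smul, Prod.smul_mk, ← WithLp.toLp_smul, ← WithLp.toLp_smul,
      Prod.smul_mk, Prod.smul_mk, smul_zero]

theorem inner_dualTrajectory (hA : Continuous A) (hT : 0 ≤ T) (w : testSpace V T)
    (U : TrajectorySpace V H T) :
    ⟪dualTrajectory j hA κ lam T w, U⟫ =
      (∫ t in (0 : ℝ)..T, ⟪Real.exp (-lam * t) • A t (w.1.2.1 t), U.fst.fst t⟫) +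
      (∫ t in (0 : ℝ)..T, ⟪Real.exp (-lam * t) • j (lam • w.1.2.1 t - w.1.2.2 t), U.fst.snd t⟫) +
      ⟪coerciveShift j A κ 0 (w.1.1 0), U.snd.fst⟫ := by
  simp only [dualTrajectory, LinearMap.coe_mk, AddHom.coe_mk, WithLp.prod_inner_apply,
    inner_continuousToL2 hT, inner_zero_left, add_zero]
  rfl

theorem weighted_test_le (hA : IsWaveFamily j A K α κ) (hlam : IsEnergyRate j K α κ lam) {e : ℝ}
    (he : 0 < e) (t : ℝ) (x y z : V) :
    e * ‖x‖ ^ 2 + e * ‖j y‖ ^ 2 + (-lam * e * ⟪coerciveShift j A κ t x, x⟫ +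
      2 * (e * ⟪coerciveShift j A κ t x, y⟫) + K * (e * ‖x‖ ^ 2)) -
        (-lam * e * ‖j y‖ ^ 2 + 2 * (e * ⟪j y, j z⟫)) ≤
      2 * (⟪e • A t y, x⟫ + ⟪e • j (lam • y - z), j y⟫) := by
  have hlower := mul_le_mul_of_nonneg_left (lower_order_le hA hlam one_pos t x (j y)) he.le
  have hshift : ⟪coerciveShift j A κ t x, y⟫ = ⟪A t y, x⟫ + κ * ⟪j y, j x⟫ := by
    rw [hA.coerciveShift_symm, real_inner_comm, inner_coerciveShift]
  rw [hshift, map_sub, map_smul, real_inner_smul_left, real_inner_smul_left, inner_sub_left,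
    real_inner_smul_left, real_inner_self_eq_norm_sq, real_inner_comm (j y) (j z)]
  rw [inv_one] at hlower
  linarith

theorem inner_dualTrajectory_trajectory (hA : Continuous A) (hT : 0 ≤ T) (w : testSpace V T) :
    ⟪dualTrajectory j hA κ lam T w, trajectory j T w⟫ =
      (∫ t in (0 : ℝ)..T, (⟪Real.exp (-lam * t) • A t (w.1.2.1 t), w.1.1 t⟫ +
        ⟪Real.exp (-lam * t) • j (lam • w.1.2.1 t - w.1.2.2 t), j (w.1.2.1 t)⟫)) +
      ⟪coerciveShift j A κ 0 (w.1.1 0), w.1.1 0⟫ := by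
  have := continuous_exp_const_mul (-lam)
  have hw := w.1.1.continuous
  have hw' := w.1.2.1.continuous
  have hw'' := w.1.2.2.continuous
  rw [inner_dualTrajectory hA hT, intervalIntegral.integral_add
    (Continuous.intervalIntegrable (by fun_prop) _ _)
    (Continuous.intervalIntegrable (by fun_prop) _ _)]
  simp only [← setIntegral_Ioo_eq_intervalIntegral hT]
  congr 2
  · refine integral_congr_ae ?_
    filter_upwards [coeFn_continuousToL2 (T := T) w.1.1] with t ht
    exact congrArg _ ht
  · refine integral_congr_ae ?_
    filter_upwards [coeFn_continuousToL2 (T := T) (applyFamily (.const ℝ j) w.1.2.1)] with t ht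
    exact congrArg _ ht

theorem energy_le_inner_dualTrajectory (hA : IsWaveFamily j A K α κ)
    (hlam : IsEnergyRate j K α κ lam) (hT : 0 ≤ T) (w : testSpace V T) :
    (∫ t in (0 : ℝ)..T, Real.exp (-lam * t) * ‖w.1.1 t‖ ^ 2) +
      (∫ t in (0 : ℝ)..T, Real.exp (-lam * t) * ‖j (w.1.2.1 t)‖ ^ 2) +
      Real.exp (-lam * T) * ⟪coerciveShift j A κ T (w.1.1 T), w.1.1 T⟫ +
      ⟪coerciveShift j A κ 0 (w.1.1 0), w.1.1 0⟫ + ‖j (w.1.2.1 0)‖ ^ 2 ≤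
    2 * ⟪dualTrajectory j hA.continuous κ lam T w, trajectory j T w⟫ := by
  rw [inner_dualTrajectory_trajectory hA.continuous hT]
  obtain ⟨⟨w, w', w''⟩, hw, hw', hw'T⟩ := w
  dsimp only at hw hw' hw'T ⊢
  have hexp := continuous_exp_const_mul (-lam)
  have hexp' := continuous_const_mul_exp_const_mul (-lam)
  have hAc := hA.continuous
  have hwc := w.continuous
  have hw'c := w'.continuous
  have hw''c := w''.continuous
  have hw_prim := isPrimitiveOn_of_hasDerivAt hw hw'c 0 T
  have hjw'_prim := isPrimitiveOn_of_hasDerivAt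
    (fun t => j.hasFDerivAt.comp_hasDerivAt t (hw' t)) (j.continuous.comp hw''c) 0 T
  have hpotential := energy_sub_le_integral hA.coerciveShift_lip hA.coerciveShift_symm
    (hasDerivAt_exp_const_mul (-lam)) hexp' (fun t => (Real.exp_pos _).le) hT hw_prim
  have hkinetic := isPrimitiveOn_mul_norm_sq (hasDerivAt_exp_const_mul (-lam)) hexp' hjw'_prim
  have hkinetic_eq := hkinetic.integral_eq_sub
  have hpotential_int := intervalIntegrable_energy (K := K) hA.continuous_coerciveShift hexp hexp'
    hw_prim
  have hw_int : IntervalIntegrable (fun t => Real.exp (-lam * t) * ‖w t‖ ^ 2) volume 0 T :=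
    Continuous.intervalIntegrable (by fun_prop) _ _
  have hw'_int : IntervalIntegrable (fun t => Real.exp (-lam * t) * ‖j (w' t)‖ ^ 2) volume 0 T :=
    Continuous.intervalIntegrable (by fun_prop) _ _
  have hle := intervalIntegral.integral_mono hT
    (((hw_int.add hw'_int).add hpotential_int).sub hkinetic.intervalIntegrable)
    (Continuous.intervalIntegrable (by fun_prop) 0 T)
    fun t => weighted_test_le hA hlam (Real.exp_pos (-lam * t)) t (w t) (w' t) (w'' t)
  rw [intervalIntegral.integral_sub ((hw_int.add hw'_int).add hpotential_int)
    hkinetic.intervalIntegrable, intervalIntegral.integral_add (hw_int.add hw'_int) hpotential_int,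
    intervalIntegral.integral_add hw_int hw'_int, intervalIntegral.integral_const_mul,
    hkinetic_eq] at hle
  simp only [Function.comp_apply, hw'T, map_zero, norm_zero, mul_zero, Real.exp_zero, one_mul,
    ne_eq, OfNat.ofNat_ne_zero, not_false_eq_true, zero_pow, zero_sub] at hle hpotential
  linarith

theorem exists_pos_mul_norm_sq_trajectory_le (hA : IsWaveFamily j A K α κ)
    (hlam : IsEnergyRate j K α κ lam) (hT : 0 ≤ T) :
    ∃ c > 0, ∀ w : testSpace V T, c * ‖trajectory j T w‖ ^ 2 ≤
      ⟪dualTrajectory j hA.continuous κ lam T w, trajectory j T w⟫ := by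
  have hlam0 : 0 ≤ lam := (by positivity : 0 ≤ |κ| + 1).trans hlam.shift_le
  set m := min 1 α
  set e := Real.exp (-lam * T)
  have hm : 0 < m := lt_min one_pos hA.pos
  have hm1 : m ≤ 1 := min_le_left _ _
  have he : 0 < e := Real.exp_pos _
  have he1 : e ≤ 1 := Real.exp_le_one_iff.2 (mul_nonpos_of_nonpos_of_nonneg (by linarith) hT)
  refine ⟨e * m / 2, by positivity, fun w => ?_⟩
  have hweight : ∀ g : ℝ → ℝ, Continuous g → (∀ t, 0 ≤ g t) →
      e * m * ∫ t in (0 : ℝ)..T, g t ≤ ∫ t in (0 : ℝ)..T, Real.exp (-lam * t) * g t :=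
    fun g hg hg0 => (mul_le_mul_of_nonneg_right (mul_le_of_le_one_right he.le hm1)
      (intervalIntegral.integral_nonneg hT fun t _ => hg0 t)).trans
        (exp_mul_integral_le hg hg0 hlam0 hT)
  have hform : ∀ t x, m * ‖x‖ ^ 2 ≤ ⟪coerciveShift j A κ t x, x⟫ := fun t x =>
    (mul_le_mul_of_nonneg_right (min_le_right _ _) (sq_nonneg _)).trans
      (hA.le_inner_coerciveShift t x)
  have hw := hweight (fun t => ‖w.1.1 t‖ ^ 2) (by fun_prop) fun t => sq_nonneg _
  have hw' := hweight (fun t => ‖j (w.1.2.1 t)‖ ^ 2) (by fun_prop) fun t => sq_nonneg _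
  have hwT := mul_le_mul_of_nonneg_left (hform T (w.1.1 T)) he.le
  have hw0 := (mul_le_of_le_one_left (mul_nonneg hm.le (sq_nonneg _)) he1).trans
    (hform 0 (w.1.1 0))
  have hw'0 : e * m * ‖j (w.1.2.1 0)‖ ^ 2 ≤ ‖j (w.1.2.1 0)‖ ^ 2 :=
    mul_le_of_le_one_left (sq_nonneg _) (mul_le_one₀ he1 hm.le hm1)
  have henergy := energy_le_inner_dualTrajectory hA hlam hT w
  rw [norm_sq_trajectory hT]
  linarith

end TestFunctions

section VariationalProblem

variable {V H : Type*} [NormedAddCommGroup V] [InnerProductSpace ℝ V] [CompleteSpace V]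
  [NormedAddCommGroup H] [InnerProductSpace ℝ H] [CompleteSpace H]

local notation "⟪" x ", " y "⟫" => inner ℝ x y

variable {j : V →L[ℝ] H} {A : ℝ → V →L[ℝ] V} {K α κ lam T : ℝ} {u₀ : V} {u₁ : H} {f : ℝ → H}
  {φ φ' : ℝ → ℝ} {U : TrajectorySpace V H T}

theorem integral_deriv_smul_of_mem_closure_range_trajectory (hT : 0 ≤ T)
    (hφ : ∀ t, HasDerivAt φ (φ' t) t) (hφ' : Continuous φ')
    (hU : U ∈ (LinearMap.range (trajectory j T)).topologicalClosure) :
    (∫ t in (0 : ℝ)..T, φ' t • j (U.fst.fst t)) + ∫ t in (0 : ℝ)..T, φ t • U.fst.snd t =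
      φ T • j U.snd.snd.fst - φ 0 • j U.snd.fst := by
  have hφc : Continuous φ := continuous_iff_continuousAt.2 fun t => (hφ t).continuousAt
  have hclosed : IsClosed {U : TrajectorySpace V H T | j (weightedIntegral T ⟨φ', hφ'⟩ U.fst.fst) +
      weightedIntegral T ⟨φ, hφc⟩ U.fst.snd = φ T • j U.snd.snd.fst - φ 0 • j U.snd.fst} :=
    isClosed_eq (by fun_prop) (by fun_prop)
  have hrange : range (trajectory j T) ⊆ {U : TrajectorySpace V H T |
      j (weightedIntegral T ⟨φ', hφ'⟩ U.fst.fst) + weightedIntegral T ⟨φ, hφc⟩ U.fst.snd =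
        φ T • j U.snd.snd.fst - φ 0 • j U.snd.fst} := by
    rintro _ ⟨⟨⟨w, w', w''⟩, hw, -, -⟩, rfl⟩
    have hjw := isPrimitiveOn_of_hasDerivAt (fun t => j.hasFDerivAt.comp_hasDerivAt t (hw t))
      (j.continuous.comp w'.continuous) 0 T
    have hparts := (isPrimitiveOn_of_hasDerivAt hφ hφ' 0 T).integral_bilin_eq_sub
      (ContinuousLinearMap.lsmul ℝ ℝ) hjw
    change j (weightedIntegral T ⟨φ', hφ'⟩ (continuousToL2 T w)) +
      weightedIntegral T ⟨φ, hφc⟩ (continuousToL2 T (applyFamily (.const ℝ j) w')) =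
        φ T • j (w T) - φ 0 • j (w 0)
    rw [weightedIntegral_continuousToL2 hT, weightedIntegral_continuousToL2 hT]
    simp only [ContinuousMap.coe_mk]
    rw [← j.intervalIntegral_comp_comm
      (intervalIntegrable_smul (w.continuous.intervalIntegrable 0 T) hφ')]
    simp only [map_smul]
    exact hparts
  have hmem := closure_minimal hrange hclosed hU
  rw [mem_ofPred_eq, weightedIntegral_apply hT, weightedIntegral_apply hT,
    ContinuousMap.coe_mk, ContinuousMap.coe_mk,
    ← j.intervalIntegral_comp_comm (intervalIntegrable_smul
      (intervalIntegrable_of_memLp_two hT (Lp.memLp U.fst.fst)) hφ')] at hmem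
  simpa only [map_smul] using hmem

/-- The variational problem for the wave equation with data `u₀`, `u₁` and `f`, obtained by
integrating `⟪f - ü - A u, exp (-lam * t) • ẇ⟫` by parts for test functions `w`. -/
structure IsVariationalSolution (j : V →L[ℝ] H) (A : ℝ → V →L[ℝ] V) (κ lam T : ℝ) (u₀ : V)
    (u₁ : H) (f : ℝ → H) (U : TrajectorySpace V H T) : Prop where
  mem_closure : U ∈ (LinearMap.range (trajectory j T)).topologicalClosure
  equation : ∀ w : testSpace V T,
    (∫ t in (0 : ℝ)..T, ⟪Real.exp (-lam * t) • A t (w.1.2.1 t), U.fst.fst t⟫) +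
      (∫ t in (0 : ℝ)..T, ⟪Real.exp (-lam * t) • j (lam • w.1.2.1 t - w.1.2.2 t), U.fst.snd t⟫) +
      ⟪coerciveShift j A κ 0 (w.1.1 0), U.snd.fst⟫ =
    (∫ t in (0 : ℝ)..T, ⟪Real.exp (-lam * t) • f t, j (w.1.2.1 t)⟫) +
      ⟪coerciveShift j A κ 0 u₀, w.1.1 0⟫ + ⟪u₁, j (w.1.2.1 0)⟫

theorem exists_isVariationalSolution (hA : IsWaveFamily j A K α κ)
    (hlam : IsEnergyRate j K α κ lam) (hT : 0 ≤ T) (u₀ : V) (u₁ : H)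
    (hf : MemLp f 2 (volume.restrict (Ioo 0 T))) :
    ∃ U : TrajectorySpace V H T, IsVariationalSolution j A κ lam T u₀ u₁ f U := by
  obtain ⟨c, hc, hcoercive⟩ := exists_pos_mul_norm_sq_trajectory_le hA hlam hT
  have hef : MemLp (fun t => Real.exp (-lam * t) • f t) 2 (volume.restrict (Ioo 0 T)) :=
    memLp_two_bilin_of_continuous (.lsmul ℝ ℝ) (continuous_exp_const_mul (-lam)) hf
  obtain ⟨U, hU, hUeq⟩ := exists_mem_closure_range_inner_eq (trajectory j T)
    (dualTrajectory j hA.continuous κ lam T) (innerSL ℝ (.toLp 2 (.toLp 2 (0, hef.toLp),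
      .toLp 2 (coerciveShift j A κ 0 u₀, .toLp 2 (0, u₁))))) hc hcoercive
  refine ⟨U, hU, fun w => ?_⟩
  rw [← inner_dualTrajectory hA.continuous hT, hUeq]
  simp only [trajectory, LinearMap.coe_mk, AddHom.coe_mk, innerSL_apply_apply,
    WithLp.prod_inner_apply, inner_zero_left, zero_add, add_assoc]
  congr 1
  rw [L2.inner_def, ← setIntegral_Ioo_eq_intervalIntegral hT]
  refine integral_congr_ae ?_
  filter_upwards [hef.coeFn_toLp, coeFn_continuousToL2 (T := T)
    (applyFamily (.const ℝ j) w.1.2.1)] with t hft hwt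
  rw [hft, hwt]
  rfl

theorem exists_testSpace_exp_smul_eq (lam : ℝ) (hφ : ContDiff ℝ ∞ φ) (hφT : φ T = 0) (v : V) :
    ∃ w : testSpace V T, w.1.1 0 = 0 ∧ w.1.2.1 0 = φ 0 • v ∧
      (∀ t, Real.exp (-lam * t) • w.1.2.1 t = φ t • v) ∧
      ∀ t, Real.exp (-lam * t) • (lam • w.1.2.1 t - w.1.2.2 t) = -(deriv φ t • v) := by
  have hφc := hφ.continuous
  have hφ' := hφ.continuous_deriv (by simp)
  have := continuous_exp_const_mul lam
  let w' : C(ℝ, V) := ⟨fun t => (Real.exp (lam * t) * φ t) • v, by fun_prop⟩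
  let w'' : C(ℝ, V) :=
    ⟨fun t => (lam * Real.exp (lam * t) * φ t + Real.exp (lam * t) * deriv φ t) • v, by fun_prop⟩
  let w : C(ℝ, V) := ⟨fun t => ∫ s in (0 : ℝ)..t, w' s,
    intervalIntegral.continuous_primitive (fun _ _ => w'.continuous.intervalIntegrable _ _) 0⟩
  have hw' : ∀ t, HasDerivAt w' (w'' t) t := fun t =>
    ((hasDerivAt_exp_const_mul lam t).mul
      (hφ.differentiable (by simp) t).hasDerivAt).smul_const v
  have hcancel : ∀ t, Real.exp (-lam * t) * Real.exp (lam * t) = 1 := fun t => by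
    rw [← Real.exp_add, neg_mul, neg_add_cancel, Real.exp_zero]
  refine ⟨⟨(w, w', w''), fun t => (w'.continuous.integral_hasStrictDerivAt 0 t).hasDerivAt, hw',
    by simp [w', hφT]⟩, intervalIntegral.integral_same, by simp [w'], fun t => ?_, fun t => ?_⟩
  · simp only [w', ContinuousMap.coe_mk, smul_smul, ← mul_assoc, hcancel, one_mul]
  · simp only [w', w'', ContinuousMap.coe_mk, smul_smul, ← sub_smul, ← neg_smul]
    congr 1
    linear_combination (-deriv φ t) * hcancel t

namespace IsVariationalSolution

theorem initial_eq (hA : IsWaveFamily j A K α κ)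
    (h : IsVariationalSolution j A κ lam T u₀ u₁ f U) : U.snd.fst = u₀ := by
  set x := U.snd.fst
  have hconst := h.equation ⟨(.const ℝ (x - u₀), 0, 0), fun t => hasDerivAt_const t _,
    fun t => hasDerivAt_const t _, rfl⟩
  simp only [ContinuousMap.const_apply, ContinuousMap.zero_apply, map_zero, smul_zero, sub_zero,
    inner_zero_left, inner_zero_right, intervalIntegral.integral_zero, zero_add, add_zero] at hconst
  have hzero : ⟪coerciveShift j A κ 0 (x - u₀), x - u₀⟫ = 0 := by
    rw [inner_sub_right, hconst, hA.coerciveShift_symm, real_inner_comm, sub_self]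
  have hnorm : α * ‖x - u₀‖ ^ 2 ≤ 0 := (hA.le_inner_coerciveShift 0 _).trans_eq hzero
  have hnorm' : ‖x - u₀‖ ^ 2 = 0 :=
    le_antisymm (nonpos_of_mul_nonpos_right hnorm hA.pos) (sq_nonneg _)
  exact sub_eq_zero.1 (norm_eq_zero.1 (pow_eq_zero_iff two_ne_zero |>.1 hnorm'))

theorem terminal_eq (hA : IsWaveFamily j A K α κ) (hT : 0 ≤ T)
    (h : IsVariationalSolution j A κ lam T u₀ u₁ f U) :
    j U.snd.snd.fst = j u₀ + ∫ t in (0 : ℝ)..T, U.fst.snd t := by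
  have hone := integral_deriv_smul_of_mem_closure_range_trajectory hT
    (fun t => hasDerivAt_const t 1) continuous_const h.mem_closure
  simp only [zero_smul, intervalIntegral.integral_zero, zero_add, one_smul, h.initial_eq hA] at hone
  rw [hone, add_sub_cancel]

theorem integral_deriv_smul_velocity (hA : IsWaveFamily j A K α κ) (hT : 0 ≤ T)
    (hf : MemLp f 2 (volume.restrict (Ioo 0 T)))
    (h : IsVariationalSolution j A κ lam T u₀ u₁ f U) (hφ : ContDiff ℝ ∞ φ) (hφT : φ T = 0) :
    (∫ t in (0 : ℝ)..T, deriv φ t • j.adjoint (U.fst.snd t)) +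
      ∫ t in (0 : ℝ)..T, φ t • (j.adjoint (f t) - A t (U.fst.fst t)) =
    -(φ 0 • j.adjoint u₁) := by
  have hφ' := hφ.continuous_deriv (by simp)
  have hp := intervalIntegrable_smul (intervalIntegrable_clm_comp j.adjoint
    (intervalIntegrable_of_memLp_two hT (Lp.memLp U.fst.snd))) hφ'
  have hf_int := intervalIntegrable_smul (intervalIntegrable_clm_comp j.adjoint
    (intervalIntegrable_of_memLp_two hT hf)) hφ.continuous
  have hAu := intervalIntegrable_smul (hA.intervalIntegrable_apply
    (intervalIntegrable_of_memLp_two hT (Lp.memLp U.fst.fst))) hφ.continuous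
  refine ext_inner_left ℝ fun v => ?_
  obtain ⟨w, hw0, hw'0, hw', hw''⟩ := exists_testSpace_exp_smul_eq lam hφ hφT v
  have hAw : ∀ t x, ⟪Real.exp (-lam * t) • A t (w.1.2.1 t), x⟫ = ⟪v, φ t • A t x⟫ := fun t x => by
    rw [← map_smul, hw', map_smul, real_inner_smul_left, hA.symm, real_inner_smul_right]
  have hjw : ∀ t h, ⟪Real.exp (-lam * t) • j (lam • w.1.2.1 t - w.1.2.2 t), h⟫ =
      -⟪v, deriv φ t • j.adjoint h⟫ := fun t h => by
    rw [← map_smul, hw'', map_neg, map_smul, inner_neg_left, real_inner_smul_left,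
      real_inner_smul_right, ContinuousLinearMap.adjoint_inner_right]
  have hfw : ∀ t h, ⟪Real.exp (-lam * t) • h, j (w.1.2.1 t)⟫ = ⟪v, φ t • j.adjoint h⟫ :=
    fun t h => by
      rw [real_inner_smul_left, ← real_inner_smul_right, ← map_smul, hw', real_inner_comm,
        map_smul, real_inner_smul_left, real_inner_smul_right,
        ContinuousLinearMap.adjoint_inner_right]
  have hu₁ : ⟪u₁, j (w.1.2.1 0)⟫ = ⟪v, φ 0 • j.adjoint u₁⟫ := by
    rw [hw'0, real_inner_comm, map_smul, real_inner_smul_left, real_inner_smul_right,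
      ContinuousLinearMap.adjoint_inner_right]
  have hinner : ∀ {g : ℝ → V}, IntervalIntegrable g volume 0 T →
      ∫ t in (0 : ℝ)..T, ⟪v, g t⟫ = ⟪v, ∫ t in (0 : ℝ)..T, g t⟫ := fun hg =>
    (innerSL ℝ v).intervalIntegral_comp_comm hg
  have hequation := h.equation w
  simp only [hAw, hjw, hfw, hu₁, hw0, map_zero, inner_zero_left, inner_zero_right, add_zero,
    intervalIntegral.integral_neg] at hequation
  rw [hinner hp, hinner hf_int, hinner hAu] at hequation
  simp only [smul_sub]
  rw [intervalIntegral.integral_sub hf_int hAu, inner_add_right, inner_sub_right, inner_neg_right]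
  linarith

theorem isMildSolution (hA : IsWaveFamily j A K α κ) (hT : 0 ≤ T)
    (hf : MemLp f 2 (volume.restrict (Ioo 0 T)))
    (h : IsVariationalSolution j A κ lam T u₀ u₁ f U) :
    IsMildSolution j A T u₀ u₁ f U.fst.fst U.fst.snd := by
  have hu := intervalIntegrable_of_memLp_two hT (Lp.memLp U.fst.fst)
  have hp := intervalIntegrable_of_memLp_two hT (Lp.memLp U.fst.snd)
  have hf_int := intervalIntegrable_of_memLp_two hT hf
  refine ⟨Lp.memLp _, Lp.memLp _, ?_, ?_⟩
  · refine ae_eq_primitive_of_integral_deriv_smul hT (intervalIntegrable_clm_comp j hu) hp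
      fun φ hφ hφT => ?_
    rw [integral_deriv_smul_of_mem_closure_range_trajectory hT
      (fun t => (hφ.differentiable (by simp) t).hasDerivAt) (hφ.continuous_deriv (by simp))
      h.mem_closure, hφT, zero_smul, zero_sub, h.initial_eq hA]
  · exact ae_eq_primitive_of_integral_deriv_smul hT (intervalIntegrable_clm_comp _ hp)
      ((intervalIntegrable_clm_comp _ hf_int).sub (hA.intervalIntegrable_apply hu))
      fun φ hφ hφT => h.integral_deriv_smul_velocity hA hT hf hφ hφT

end IsVariationalSolution

theorem exists_isMildSolution (hA : IsWaveFamily j A K α κ) (hT : 0 ≤ T) (u₀ : V) (u₁ : H)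
    (hf : MemLp f 2 (volume.restrict (Ioo 0 T))) :
    ∃ (u : L2 T V) (p : L2 T H) (y : V),
      IsMildSolution j A T u₀ u₁ f u p ∧ j y = j u₀ + ∫ t in (0 : ℝ)..T, p t := by
  obtain ⟨lam, hlam⟩ := exists_isEnergyRate j K κ hA.pos
  obtain ⟨U, hU⟩ := exists_isVariationalSolution hA hlam hT u₀ u₁ hf
  exact ⟨_, _, _, hU.isMildSolution hA hT hf, hU.terminal_eq hA hT⟩

theorem IsMildSolution.primitive_mem_range (hA : IsWaveFamily j A K α κ)
    (hf : MemLp f 2 (volume.restrict (Ioo 0 T))) {u : ℝ → V} {p : ℝ → H}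
    (h : IsMildSolution j A T u₀ u₁ f u p) {s : ℝ} (hs : s ∈ Icc 0 T) :
    j u₀ + ∫ t in (0 : ℝ)..s, p t ∈ range j := by
  rcases hs.1.eq_or_lt with rfl | hs0
  · exact ⟨u₀, by simp⟩
  have hfs := hf.mono_measure (Measure.restrict_mono (Ioo_subset_Ioo_right hs.2) le_rfl)
  have hu := h.mono hs.2
  obtain ⟨u', p', y, hu', hy⟩ := exists_isMildSolution hA hs0.le u₀ u₁ hfs
  have hae : (fun t => j (u' t)) =ᵐ[volume.restrict (Ioo 0 s)] fun t => j (u t) :=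
    (hu'.ae_eq hA hs0.le (intervalIntegrable_of_memLp_two hs0.le hfs) hu).mono
      fun _ ht => congrArg j ht
  have hcont' := hu'.isContRep hs0.le
  have hend := (hu.isContRep hs0.le).eqOn hs0 ⟨hcont'.1, hcont'.2.trans hae⟩
    (right_mem_Icc.2 hs0.le)
  exact ⟨y, hy.trans hend.symm⟩

end VariationalProblem

section Transfer

variable {𝕜 V H : Type*} [RCLike 𝕜] [NormedAddCommGroup V] [InnerProductSpace 𝕜 V]
  [NormedAddCommGroup H] [InnerProductSpace 𝕜 H] {T : ℝ}

theorem real_inner_eq_re_inner_of_innerProductSpace (𝕜 : Type*) [RCLike 𝕜] [InnerProductSpace 𝕜 V]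
    [InnerProductSpace ℝ V] (x y : V) : inner ℝ x y = RCLike.re (inner 𝕜 x y) := by
  rw [← RCLike.re_to_real (x := inner ℝ x y)]
  simp only [re_inner_eq_norm_add_mul_self_sub_norm_sub_mul_self_div_four]

theorem normedSpace_restrictScalars_eq (𝕜 : Type*) {E : Type*} [RCLike 𝕜] [NormedAddCommGroup E]
    [NormedSpace 𝕜 E] [inst : NormedSpace ℝ E] : NormedSpace.restrictScalars ℝ 𝕜 E = inst := by
  ext r x
  exact algebraMap_smul 𝕜 r x

theorem isWeakDeriv_congr_right {E : Type*} [NormedAddCommGroup E] [NormedSpace ℝ E]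
    {g g' k' : ℝ → E} (h : g' =ᵐ[volume.restrict (Ioo 0 T)] k') :
    IsWeakDeriv T g g' ↔ IsWeakDeriv T g k' := by
  have hcongr : ∀ φ : ℝ → ℝ, ∫ t in Ioo 0 T, φ t • g' t = ∫ t in Ioo 0 T, φ t • k' t :=
    fun φ => integral_congr_ae (h.mono fun t ht => congrArg (φ t • ·) ht)
  simp only [IsWeakDeriv, hcongr]

theorem ae_map_eq_add_integral_iff_of_injective {E F : Type*} [NormedAddCommGroup E]
    [NormedSpace ℝ E] [CompleteSpace E] [NormedAddCommGroup F] [NormedSpace ℝ F] [CompleteSpace F]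
    {L : E →L[ℝ] F} (hL : Function.Injective L) {g g' : ℝ → E} {x : E}
    (hg' : IntervalIntegrable g' volume 0 T) :
    (∀ᵐ t ∂volume.restrict (Ioo 0 T), L (g t) = L x + ∫ s in (0 : ℝ)..t, L (g' s)) ↔
      ∀ᵐ t ∂volume.restrict (Ioo 0 T), g t = x + ∫ s in (0 : ℝ)..t, g' s := by
  refine Filter.eventually_congr ?_
  filter_upwards [ae_restrict_mem measurableSet_Ioo] with t ht
  rw [L.intervalIntegral_comp_comm (hg'.mono_set
    (uIcc_subset_uIcc_left (mem_uIcc_of_le ht.1.le ht.2.le))), ← map_add, hL.eq_iff]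

variable (𝕜 V) in
/-- The Riesz map `V → V'`, as a real-linear map. -/
noncomputable def rieszMap [NormedSpace ℝ V] : V →L[ℝ] AntiDual 𝕜 V :=
  (innerSLFlip 𝕜).restrictScalars ℝ

theorem rieszMap_apply [NormedSpace ℝ V] (x v : V) : rieszMap 𝕜 V x v = inner 𝕜 v x := rfl

theorem rieszMap_injective [NormedSpace ℝ V] : Function.Injective (rieszMap 𝕜 V) := fun _ _ h =>
  ext_inner_left 𝕜 fun v => DFunLike.congr_fun h v

variable [InnerProductSpace ℝ H] {j : V →L[𝕜] H}

theorem isWeakDeriv_and_hasInitialValue_fst_iff [CompleteSpace H] (hT : 0 < T) (u : L2 T V)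
    (p : L2 T H) (u₀ : V) :
    IsWeakDeriv T (fun t => j (u t)) p ∧ HasInitialValue T (fun t => j (u t)) (j u₀) ↔
      ∀ᵐ t ∂volume.restrict (Ioo 0 T), j (u t) = j u₀ + ∫ s in (0 : ℝ)..t, p s :=
  isWeakDeriv_and_hasInitialValue_iff hT
    (intervalIntegrable_of_memLp_two hT.le (j.comp_memLp' (Lp.memLp u)))
    (intervalIntegrable_of_memLp_two hT.le (Lp.memLp p))

variable {a : Icc (0 : ℝ) T → V →ₗ[𝕜] V →ₗ⋆[𝕜] 𝕜} {K α κ : ℝ} [InnerProductSpace ℝ V]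
  [CompleteSpace V]

/-- The operators on `V` that represent the forms `a t` through the real part of the inner product,
extended to all times by their values at `0` and `T`. -/
noncomputable def rieszOp (ha : IsVBounded a) (hT : 0 ≤ T) (t : ℝ) : V →L[ℝ] V :=
  (InnerProductSpace.continuousLinearMapOfBilin
    (formOp ha (projIcc 0 T hT t)).flip).restrictScalars ℝ

theorem inner_rieszOp (ha : IsVBounded a) (hT : 0 ≤ T) (t : ℝ) (x y : V) :
    inner 𝕜 (rieszOp ha hT t x) y = a (projIcc 0 T hT t) y x :=
  InnerProductSpace.continuousLinearMapOfBilin_apply _ x y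

theorem rieszMap_rieszOp (ha : IsVBounded a) (hs : IsSymmetricForm a) (hT : 0 ≤ T) (t : ℝ) (x : V) :
    rieszMap 𝕜 V (rieszOp ha hT t x) = formOp ha (projIcc 0 T hT t) x := by
  ext v
  rw [rieszMap_apply, ← inner_conj_symm, inner_rieszOp, formOp_apply, hs _ x v]

theorem norm_rieszOp_sub_le (ha : IsVBounded a) (hT : 0 ≤ T)
    (hK : ∀ (t s : Icc (0 : ℝ) T) (u v : V), ‖a t u v - a s u v‖ ≤ K * |(t : ℝ) - s| * ‖u‖ * ‖v‖)
    (s t : ℝ) : ‖rieszOp ha hT s - rieszOp ha hT t‖ ≤ |K| * |s - t| := by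
  refine ContinuousLinearMap.opNorm_le_bound _ (by positivity) fun x => ?_
  set y := (rieszOp ha hT s - rieszOp ha hT t) x
  have hinner : inner 𝕜 y y = a (projIcc 0 T hT s) y x - a (projIcc 0 T hT t) y x := by
    rw [← inner_rieszOp ha, ← inner_rieszOp ha, ← inner_sub_left, ← sub_apply]
  have hsq : ‖y‖ * ‖y‖ ≤ |K| * |s - t| * ‖x‖ * ‖y‖ :=
    calc ‖y‖ * ‖y‖ = RCLike.re (inner 𝕜 y y) := (inner_self_eq_norm_mul_norm y).symm
      _ ≤ ‖inner 𝕜 y y‖ := RCLike.re_le_norm _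
      _ ≤ K * |(projIcc 0 T hT s : ℝ) - projIcc 0 T hT t| * ‖y‖ * ‖x‖ := by
        rw [hinner]; exact hK _ _ y x
      _ ≤ |K| * |s - t| * ‖y‖ * ‖x‖ := by
        have hproj := abs_projIcc_sub_projIcc hT (c := s) (d := t)
        gcongr
        exact le_abs_self K
      _ = |K| * |s - t| * ‖x‖ * ‖y‖ := by ring
  rcases (norm_nonneg y).eq_or_lt with hzero | hpos
  · rw [← hzero]; positivity
  · exact le_of_mul_le_mul_right hsq hpos

theorem isWaveFamily_rieszOp (ha : IsVBounded a) (hT : 0 ≤ T) (hs : IsSymmetricForm a)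
    (hK : ∀ (t s : Icc (0 : ℝ) T) (u v : V), ‖a t u v - a s u v‖ ≤ K * |(t : ℝ) - s| * ‖u‖ * ‖v‖)
    (hα : 0 < α)
    (hc : ∀ (t : Icc (0 : ℝ) T) (u : V), α * ‖u‖ ^ 2 ≤ RCLike.re (a t u u) + κ * ‖j u‖ ^ 2) :
    IsWaveFamily (j.restrictScalars ℝ) (rieszOp ha hT) |K| α κ where
  lip := norm_rieszOp_sub_le ha hT hK
  symm t x y := by
    rw [real_inner_eq_re_inner_of_innerProductSpace 𝕜,
      real_inner_eq_re_inner_of_innerProductSpace 𝕜, inner_rieszOp, ← inner_conj_symm,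
      inner_rieszOp, hs]
  pos := hα
  coercive t x := by
    rw [real_inner_eq_re_inner_of_innerProductSpace 𝕜, inner_rieszOp]
    exact hc _ x

theorem IsWaveFamily.memLp_apply {V H : Type*} [NormedAddCommGroup V] [InnerProductSpace ℝ V]
    [NormedAddCommGroup H] [InnerProductSpace ℝ H] {j : V →L[ℝ] H} {A : ℝ → V →L[ℝ] V}
    (hA : IsWaveFamily j A K α κ) {u : ℝ → V} (hu : MemLp u 2 (volume.restrict (Ioo 0 T))) :
    MemLp (fun t => A t (u t)) 2 (volume.restrict (Ioo 0 T)) :=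
  memLp_two_bilin_of_continuous (ContinuousLinearMap.id ℝ (V →L[ℝ] V)) hA.continuous hu

variable [CompleteSpace H]

theorem rieszMap_adjoint (j : V →L[𝕜] H) (h : H) :
    rieszMap 𝕜 V ((j.restrictScalars ℝ).adjoint h) = toAntiDual j h := by
  have hadjoint : (j.restrictScalars ℝ).adjoint h = j.adjoint h := by
    refine ext_inner_left ℝ fun v => ?_
    rw [ContinuousLinearMap.adjoint_inner_right, real_inner_eq_re_inner_of_innerProductSpace 𝕜,
      real_inner_eq_re_inner_of_innerProductSpace 𝕜, ContinuousLinearMap.adjoint_inner_right,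
      ContinuousLinearMap.coe_restrictScalars']
  ext v
  rw [hadjoint, rieszMap_apply, toAntiDual_apply, ContinuousLinearMap.adjoint_inner_right]

theorem add_formOp_eq_toAntiDual_iff (ha : IsVBounded a) (hs : IsSymmetricForm a) {t : ℝ}
    (ht : t ∈ Icc 0 T) (x : V) (h : H) (y : AntiDual 𝕜 V) :
    y + formOp ha ⟨t, ht⟩ x = toAntiDual j h ↔
      y = rieszMap 𝕜 V ((j.restrictScalars ℝ).adjoint h - rieszOp ha (ht.1.trans ht.2) t x) := by
  rw [map_sub, rieszMap_adjoint, rieszMap_rieszOp ha hs, projIcc_of_mem _ ht, eq_sub_iff_add_eq]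

theorem isWeakDeriv_and_hasInitialValue_snd_iff (hT : 0 < T) {g : ℝ → V}
    (hg : IntervalIntegrable g volume 0 T) (p : L2 T H) (u₁ : H) :
    IsWeakDeriv T (fun t => toAntiDual j (p t)) (fun t => rieszMap 𝕜 V (g t)) ∧
        HasInitialValue T (fun t => toAntiDual j (p t)) (toAntiDual j u₁) ↔
      ∀ᵐ t ∂volume.restrict (Ioo 0 T), (j.restrictScalars ℝ).adjoint (p t) =
        (j.restrictScalars ℝ).adjoint u₁ + ∫ s in (0 : ℝ)..t, g s := by
  rw [← ae_map_eq_add_integral_iff_of_injective (rieszMap_injective (𝕜 := 𝕜)) hg]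
  simp only [← rieszMap_adjoint]
  exact isWeakDeriv_and_hasInitialValue_iff hT
    (intervalIntegrable_of_memLp_two hT.le ((rieszMap 𝕜 V).comp_memLp'
      ((j.restrictScalars ℝ).adjoint.comp_memLp' (Lp.memLp p))))
    (intervalIntegrable_clm_comp _ hg)

theorem isWaveSolution_iff_exists_isMildSolution (hT : 0 < T) (ha : IsVBounded a)
    (hs : IsSymmetricForm a) (hA : IsWaveFamily (j.restrictScalars ℝ) (rieszOp ha hT.le) K α κ)
    (f : L2 T H) (u₀ : V) (u₁ : H) (u : L2 T V) :
    IsWaveSolution j ha f u₀ u₁ u ↔ ∃ p : L2 T H,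
      IsMildSolution (j.restrictScalars ℝ) (rieszOp ha hT.le) T u₀ u₁ f u p := by
  set g : ℝ → V := fun t =>
    (j.restrictScalars ℝ).adjoint (f t) - rieszOp ha hT.le t (u t)
  have hg : MemLp g 2 (volume.restrict (Ioo 0 T)) :=
    ((j.restrictScalars ℝ).adjoint.comp_memLp' (Lp.memLp f)).sub (hA.memLp_apply (Lp.memLp u))
  have hequation : ∀ u'' : L2 T (AntiDual 𝕜 V),
      (∀ᵐ t : ℝ, ∀ ht : t ∈ Ioo 0 T,
        u'' t + formOp ha ⟨t, Ioo_subset_Icc_self ht⟩ (u t) = toAntiDual j (f t)) ↔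
      u'' =ᵐ[volume.restrict (Ioo 0 T)] fun t => rieszMap 𝕜 V (g t) := fun u'' => by
    rw [Filter.EventuallyEq, ae_restrict_iff' measurableSet_Ioo]
    exact Filter.eventually_congr (ae_of_all _ fun t => forall_congr' fun ht =>
      add_formOp_eq_toAntiDual_iff ha hs (Ioo_subset_Icc_self ht) _ _ _)
  have hfst := fun p => isWeakDeriv_and_hasInitialValue_fst_iff (j := j) hT u p u₀
  have hsnd := fun p => isWeakDeriv_and_hasInitialValue_snd_iff (j := j) hT
    (intervalIntegrable_of_memLp_two hT.le hg) p u₁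
  constructor
  · rintro ⟨p, u'', ⟨hp, hu''⟩, heq, hu₀, hu₁⟩
    rw [normedSpace_restrictScalars_eq] at hp
    exact ⟨p, Lp.memLp u, Lp.memLp p, (hfst p).1 ⟨hp, hu₀⟩,
      (hsnd p).1 ⟨(isWeakDeriv_congr_right ((hequation u'').1 heq)).1 hu'', hu₁⟩⟩
  · rintro ⟨p, h⟩
    obtain ⟨hp, hu₀⟩ := (hfst p).2 h.first
    obtain ⟨hu'', hu₁⟩ := (hsnd p).2 h.second
    have hRg := (rieszMap 𝕜 V).comp_memLp' hg
    exact ⟨p, hRg.toLp, ⟨by rwa [normedSpace_restrictScalars_eq],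
      (isWeakDeriv_congr_right hRg.coeFn_toLp).2 hu''⟩, (hequation _).2 hRg.coeFn_toLp, hu₀, hu₁⟩

end Transfer

end WaveMR

theorem mainTheorem4_general {𝕜 V H : Type*} [RCLike 𝕜]
    [NormedAddCommGroup V] [InnerProductSpace 𝕜 V] [CompleteSpace V]
    [NormedAddCommGroup H] [InnerProductSpace 𝕜 H] [CompleteSpace H]
    (j : V →L[𝕜] H) {T : ℝ} (hT : 0 < T)
    (a : Icc (0 : ℝ) T → V →ₗ[𝕜] V →ₗ⋆[𝕜] 𝕜)
    (ha : WaveMR.IsVBounded a)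
    (ha_coercive : WaveMR.IsQuasiCoercive j a)
    (ha_symm : WaveMR.IsSymmetricForm a)
    (ha_lip : WaveMR.IsLipschitzForm a)
    (u₀ : V) (u₁ : H) (f : WaveMR.L2 T H) :
    (∃! u : WaveMR.L2 T V, WaveMR.IsWaveSolution j ha f u₀ u₁ u) ∧
      ∀ u : WaveMR.L2 T V, WaveMR.IsWaveSolution j ha f u₀ u₁ u →
        ∀ U : ℝ → H, WaveMR.IsContRep T (fun t => j (u t)) U →
          ∀ t ∈ Icc 0 T, U t ∈ Set.range j := by
  let _ : InnerProductSpace ℝ V := InnerProductSpace.rclikeToReal 𝕜 V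
  let _ : InnerProductSpace ℝ H := InnerProductSpace.rclikeToReal 𝕜 H
  obtain ⟨α, hα, κ, hc⟩ := ha_coercive
  obtain ⟨K, hK⟩ := ha_lip
  have hA := WaveMR.isWaveFamily_rieszOp ha hT.le ha_symm hK hα hc
  have hf := WaveMR.intervalIntegrable_of_memLp_two hT.le (Lp.memLp f)
  simp only [WaveMR.isWaveSolution_iff_exists_isMildSolution hT ha ha_symm hA]
  refine ⟨?_, fun u ⟨p, hu⟩ U hU t ht => ?_⟩
  · obtain ⟨u, p, -, hu, -⟩ := WaveMR.exists_isMildSolution hA hT.le u₀ u₁ (Lp.memLp f)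
    exact ⟨u, ⟨p, hu⟩, fun u' ⟨p', hu'⟩ => Lp.ext (hu'.ae_eq hA hT.le hf hu)⟩
  · rw [hU.eqOn hT (hu.isContRep hT.le) ht]
    exact hu.primitive_mem_range hA (Lp.memLp f) ht

theorem mainTheorem4 {𝕜 V H : Type*} [RCLike 𝕜]
    [NormedAddCommGroup V] [InnerProductSpace 𝕜 V] [CompleteSpace V]
    [TopologicalSpace.SeparableSpace V]
    [NormedAddCommGroup H] [InnerProductSpace 𝕜 H] [CompleteSpace H]
    [TopologicalSpace.SeparableSpace H]
    (j : V →L[𝕜] H) (hj_inj : Function.Injective j) (hj_dense : DenseRange j)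
    {T : ℝ} (hT : 0 < T)
    (a : Icc (0 : ℝ) T → V →ₗ[𝕜] V →ₗ⋆[𝕜] 𝕜)
    (ha : WaveMR.IsVBounded a)
    (ha_coercive : WaveMR.IsQuasiCoercive j a)
    (ha_symm : WaveMR.IsSymmetricForm a)
    (ha_lip : WaveMR.IsLipschitzForm a)
    (u₀ : V) (u₁ : H) (f : WaveMR.L2 T H) :
    (∃! u : WaveMR.L2 T V, WaveMR.IsWaveSolution j ha f u₀ u₁ u) ∧
      ∀ u : WaveMR.L2 T V, WaveMR.IsWaveSolution j ha f u₀ u₁ u →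
        ∀ U : ℝ → H, WaveMR.IsContRep T (fun t => j (u t)) U →
          ∀ t ∈ Icc 0 T, U t ∈ Set.range j :=
  mainTheorem4_general j hT a ha ha_coercive ha_symm ha_lip u₀ u₁ f
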